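/- Let $T>0$, $\tfrac12<\alpha<1$, let $(\Omega,\mathcal F,\mathbb P)$ be a complete probability space with a left-continuous filtration $\mathbb F=(\mathcal F_t)_{t\in[0,T]}$, and let $X=(X_t)_{t\in[0,T]}$ be an $\mathbb F$-adapted process. For $t\in(0,T]$ write $X\in\mathcal X^\alpha_t$ if $X$ restricted to $[0,t]$ is a centered continuous Gaussian process and there is $\delta\in(0,t]$ such that for every $u\in[t-\delta,t)$ the process $Y_r=X_{r+u}-X_u$, $r\in[0,t-u]$, satisfies (all times ranging in $[0,t-u]$): 1. $\mathbb E[Y_rY_s]>0$ for all $r,s>0$; 2. there is $C>0$ with $\mathbb E[(Y_{r+s}-Y_s)^2]\le C r^{2\alpha}$ for all $r,s\ge 0$ with $r+s\le t-u$; 3. there are $c,\hat\delta>0$ with $\mathbb E[Y_s^2]\ge c s^2$ for $s\le\hat\delta$; 4. there is $\hat\delta>0$ with $\sup_{0<r<2\hat\delta}\ \sup_{r/2\le s\le r}\mathbb E[Y_s^2]/\mathbb E[Y_rY_s]<\infty$. Say that $X$ satisfies the small ball assumption at $t$ if there are $C,\Delta>0$ and $\delta\in(0,t]$ such that for all $r<s$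 in $[t-\delta,t]$ with $s-r\le\Delta$ and all $0<\varepsilon\le (s-r)^\alpha$, $$\mathbb P\Big(\sup_{r\le v\le s}|X_v-X_r|\le\varepsilon\Big)\le\exp\big(-C(s-r)\varepsilon^{-1/\alpha}\big).$$ For $0<\beta<1$ and $t>0$ let $W^\beta_2([0,t])$ be the space of measurable $f:[0,t]\to\mathbb R$ with $$\|f\|_{t,\beta}=\int_0^t\frac{|f(s)|}{s^\beta}\,ds+\int_0^t\int_0^s\frac{|f(s)-f(u)|}{(s-u)^{1+\beta}}\,du\,ds<\infty .$$ For $f\in W_2^\beta([0,t])$ and continuous $g:[0,t]\to\mathbb R$, the generalized Lebesgue–Stieltjes integral, computed with order $\beta$, is $$\int_0^t f\,dg=-\int_0^t \big(D^\beta_{0+}f\big)(s)\,\big(D^{1-\beta}_{t-}g_{t-}\big)(s)\,ds,\qquad g_{t-}=g-g(t),$$ where $$D^\beta_{0+}f(s)=\frac1{\Gamma(1-\beta)}\Big(\frac{f(s)}{s^\beta}+\beta\int_0^s\frac{f(s)-f(u)}{(s-u)^{\beta+1}}du\Big),\qquad D^{\beta}_{t-}h(s)=\frac1{\Gamma(1-\beta)}\Big(\frac{h(s)}{(t-s)^\beta}+\beta\int_s^t\frac{h(s)-h(u)}{(u-s)^{\beta+1}}du\Big);$$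 it exists if the integral defining $D^{1-\beta}_{t-}g_{t-}(s)$ converges absolutely for almost every $s\in(0,t)$ and the product $D^\beta_{0+}f\cdot D^{1-\beta}_{t-}g_{t-}$ is Lebesgue integrable on $(0,t)$. **Corollary.** Suppose that for every $t\in(0,T]$ we have $X\in\mathcal X^\alpha_t$ and $X$ satisfies the small ball assumption at $t$. Let $Z=(Z_t)_{t\in[0,T]}$ be an $\mathbb F$-adapted process which is almost surely Hölder continuous on $[0,T]$ of order $a>1-\alpha$. Then for every $t\in(0,T]$ there exist an $\mathbb F$-adapted process $\Psi_t=(\Psi_t(s))_{s\in[0,t]}$ and $\beta_0\in(1-\alpha,1)$ such that, almost surely, for every $\beta\in(1-\alpha,\beta_0]$ the path of $\Psi_t$ lies in $W_2^\beta([0,t])$, the generalized Lebesgue–Stieltjes integral of order $\beta$ exists, and $$\int_0^t\Psi_t(s)\,dX_s=Z_t .$$ In other words, the process $t\mapsto\int_0^t\Psi_t(s)\,dX_s$, $t\in(0,T]$, is a version of $Z$. -/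

import Mathlib

open MeasureTheory ProbabilityTheory Set
open scoped NNReal ENNReal

noncomputable section

namespace GaussianRep

variable {Ω : Type*} {mΩ : MeasurableSpace Ω}

/-- The covariance `R_X(t,s) = E[X_t X_s]` of a centered process. -/
def covFn (P : Measure Ω) (X : ℝ → Ω → ℝ) (t s : ℝ) : ℝ :=
  ∫ ω, X t ω * X s ω ∂P

/-- The incremental variance `W_X(t,s) = E[(X_t - X_s)^2]`. -/
def incVar (P : Measure Ω) (X : ℝ → Ω → ℝ) (t s : ℝ) : ℝ :=
  ∫ ω, (X t ω - X s ω) ^ 2 ∂P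

/-- The variance `V_X(t) = E[X_t^2]` of a centered process. -/
def varFn (P : Measure Ω) (X : ℝ → Ω → ℝ) (t : ℝ) : ℝ :=
  ∫ ω, X t ω ^ 2 ∂P

/-- The incremental process `Y_r = X_{r+u} - X_u`. -/
def shiftInc (X : ℝ → Ω → ℝ) (u r : ℝ) (ω : Ω) : ℝ :=
  X (r + u) ω - X u ω

/-- The covariance conditions on a process `Y = (Y_r)`, `r ∈ [0, L]`.
Bounds on suprema are written pointwise. -/
structure LocalCovConditions (P : Measure Ω) (α L : ℝ) (Y : ℝ → Ω → ℝ) : Prop where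
  cov_pos : ∀ s ∈ Ioc 0 L, ∀ t ∈ Ioc 0 L, 0 < covFn P Y s t
  incVar_le : ∃ C > 0, ∀ t ∈ Icc 0 L, ∀ s ∈ Icc 0 (L - t),
    incVar P Y (t + s) s ≤ C * t ^ (2 * α)
  le_var : ∃ c > 0, ∃ d > 0, ∀ s ∈ Icc 0 L, s ≤ d → c * s ^ 2 ≤ varFn P Y s
  ratio_bdd : ∃ d > 0, ∃ K : ℝ, ∀ t ∈ Ioc 0 L, t < 2 * d → ∀ s ∈ Icc (t / 2) t,
    covFn P Y s s / covFn P Y t s ≤ K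

/-- The class `𝒳^α_T` of centered continuous Gaussian processes on `[0,T]` whose increments
close to `T` satisfy the covariance conditions. Only the values of `X` on `[0,T]` matter. -/
structure MemClass (P : Measure Ω) (α T : ℝ) (X : ℝ → Ω → ℝ) : Prop where
  gaussian : IsGaussianProcess (fun t : Icc (0 : ℝ) T => X t) P
  centered : ∀ t ∈ Icc 0 T, ∫ ω, X t ω ∂P = 0
  continuous : ∀ᵐ ω ∂P, ContinuousOn (fun t => X t ω) (Icc 0 T)
  local_cov : ∃ δ ∈ Ioc 0 T, ∀ u ∈ Ico (T - δ) T,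
    LocalCovConditions P α (T - u) (shiftInc X u)

/-- The small ball assumption close to `T`: on short intervals `[s,t]` close to `T`,
`P(sup_{s ≤ u ≤ t} |X_u - X_s| ≤ ε) ≤ exp(-C (t-s) ε^{-1/α})` for `0 < ε ≤ (t-s)^α`. -/
def SmallBall (P : Measure Ω) (α T : ℝ) (X : ℝ → Ω → ℝ) : Prop :=
  ∃ C > 0, ∃ δ ∈ Ioc 0 T, ∃ Δ > 0, ∀ s ∈ Icc (T - δ) T, ∀ t ∈ Icc (T - δ) T,
    s < t → t - s ≤ Δ → ∀ ε : ℝ, 0 < ε → ε ≤ (t - s) ^ α →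
      P.real {ω | ∀ u ∈ Icc s t, |X u ω - X s ω| ≤ ε} ≤
        Real.exp (-(C * (t - s) * ε ^ (-(1 / α))))

/-- The fractional Besov norm `‖f‖_{t,β}` on `[0,t]` (of type `W^β_2`), as an extended number. -/
def besovNorm (β t : ℝ) (f : ℝ → ℝ) : ℝ≥0∞ :=
  (∫⁻ s in Ioo 0 t, ENNReal.ofReal (|f s| / s ^ β)) +
    ∫⁻ s in Ioo 0 t, ∫⁻ u in Ioo 0 s, ENNReal.ofReal (|f s - f u| / (s - u) ^ (1 + β))

/-- The fractional Besov space `W^β_2([0,t])`. -/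
def MemBesov (β t : ℝ) (f : ℝ → ℝ) : Prop :=
  Measurable (fun s : Icc 0 t => f s) ∧ besovNorm β t f < ∞

/-- Weyl representation of the fractional derivative `D^β_{0+} f` at `s`. -/
def weylLeft (β : ℝ) (f : ℝ → ℝ) (s : ℝ) : ℝ :=
  (1 / Real.Gamma (1 - β)) *
    (f s / s ^ β + β * ∫ u in Ioo 0 s, (f s - f u) / (s - u) ^ (β + 1))

/-- Weyl representation of the fractional derivative `D^β_{t-} g` at `s`, without the complex
phase factor (the phases in the definition of the integral multiply to `-1`). -/
def weylRight (β t : ℝ) (g : ℝ → ℝ) (s : ℝ) : ℝ :=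
  (1 / Real.Gamma (1 - β)) *
    (g s / (t - s) ^ β + β * ∫ u in Ioo s t, (g s - g u) / (u - s) ^ (β + 1))

/-- The generalized Lebesgue-Stieltjes integral of `f` with respect to the continuous
function `g` on `[0,t]`, computed with the order `β`, exists and equals `I`:
`f ∈ W^β_2([0,t])`, the Weyl derivative `D^{1-β}_{t-} g_{t-}` with `g_{t-} = g - g(t)` is given by
a convergent integral almost everywhere, and
`D^β_{0+} f · D^{1-β}_{t-} g_{t-}` is Lebesgue integrable with integral `I` (up to the
phase `-1`). -/
structure HasGLSIntegral (β : ℝ) (f g : ℝ → ℝ) (t I : ℝ) : Prop where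
  order_mem : β ∈ Ioo (0 : ℝ) 1
  memBesov : MemBesov β t f
  continuousOn : ContinuousOn g (Icc 0 t)
  convergent : ∀ᵐ s ∂(volume.restrict (Ioo 0 t)),
    IntegrableOn (fun u => (g s - g u) / (u - s) ^ ((1 - β) + 1)) (Ioo s t)
  integrable : IntegrableOn
    (fun s => weylLeft β f s * weylRight (1 - β) t (fun r => g r - g t) s) (Ioo 0 t)
  eq_integral :
    I = -∫ s in Ioo 0 t, weylLeft β f s * weylRight (1 - β) t (fun r => g r - g t) s

end GaussianRep

end

/-! The integrand is a strategy that trades against the path of `X` on a short interval `(t - D,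
t]`, along the times `t_n = t - D / 2^n`, with `Δ_n = t_{n+1} - t_n`. Let `e_n` be `Z` at `t_n`
minus the integral accumulated so far. On `(t_n, t_{n+1}]` the strategy tries to gain `e_n`: it
holds `(2 e_n / ρ_n²) (X - X_{t_n})`, frozen on the cells of a grid, until the grid values first
leave `[-ρ_n, ρ_n]`. Since `2 x_i (x_{i+1} - x_i) = x_{i+1}² - x_i² - (x_{i+1} - x_i)²`, the gain is
`e_n / ρ_n²` times the squared exit value minus a quadratic variation. Paths are Hölder of an order
above `1/2` near `t`, so on a fine enough grid both the overshoot and the quadratic variation are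
negligible against `ρ_n²` (`abs_sum_stopped_sub_one_le`, `eventually_quadratic_le`). The threshold
`ρ_n = Δ_n^(α+η) / 2` lies below the natural scale `Δ_n^α`, so the small ball bound and
Borel-Cantelli make the exit happen on all but finitely many intervals
(`SmallBall.ae_eventually_exit`).

Hence `e_{n+1}` is at most `|e_n| / 8` plus an increment of `Z`, and `e_n = O(2^(-b n))` for `b` the
Hölder order of `Z` capped at 1 (`exists_target_bound`). The gains up to `t_n` telescope to `Z_{t_n}
- e_n`, which tends to `Z_t` (`tsum_position_mul_sub`).

It remains to see that this sum of gains is the generalized Lebesgue-Stieltjes integral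
(`hasGLSIntegral_step`). For one interval `(l, r]` the left Weyl derivative of the indicator is a
difference of two kernels `(s - l)_+^(-β)` and `(s - r)_+^(-β)`; integrating such a kernel against
the right Weyl derivative of a Hölder function inverts that derivative
(`integral_rpow_mul_weylRight`). An indicator of length `h` has Besov norm `O(h^(1-β))`, so
countably many cells may be summed once positions times `h^(1-β)` are summable. The geometric decay
of `e_n` pays for this when `β` is close to `1 - α` and the exponents `κ` (grid) and `η` (threshold)
are small compared with `b`.

Positions vanish before `t - D`, so only Hölder continuity near `t` enters the value of the
integral. Convergence of the right Weyl derivative at almost every earlier time comes from a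
countable cover by left neighbourhoods on which `X` is Hölder (`exists_countable_cover_left`). -/

open Filter Topology

namespace GaussianRep

/-! ### Hölder continuity of Gaussian paths: tail bound, dyadic chaining, Borel-Cantelli. -/

section Holder

/-- Two-sided Gaussian tail bound for a centered Gaussian variable. -/
lemma measureReal_abs_ge_le_of_hasGaussianLaw {Ω : Type*} {mΩ : MeasurableSpace Ω} {P : Measure Ω}
    [IsProbabilityMeasure P] {Y : Ω → ℝ} (hY : HasGaussianLaw Y P) (h0 : ∫ ω, Y ω ∂P = 0)
    {v : ℝ} (hv : ∫ ω, Y ω ^ 2 ∂P ≤ v) {x : ℝ} (hx : 0 ≤ x) :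
    P.real {ω | x ≤ |Y ω|} ≤ 2 * Real.exp (-x ^ 2 / (2 * v)) := by
  have hvar : Var[Y; P] ≤ v := by
    rw [variance_of_integral_eq_zero hY.aemeasurable h0]; exact hv
  have hv0 : 0 ≤ v := (variance_nonneg Y P).trans hvar
  have hmap : P.map Y = gaussianReal 0 (Var[Y; P]).toNNReal := by
    have := hY.map_eq_gaussianReal
    rwa [h0] at this
  -- The Chernoff bound needs only an upper bound on the variance, so degenerate laws require no
  -- separate treatment.
  have hsub : HasSubgaussianMGF Y v.toNNReal P := by
    refine ⟨fun t => ?_, fun t => ?_⟩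
    · have h1 := integrable_exp_mul_gaussianReal (μ := 0) (v := (Var[Y; P]).toNNReal) t
      rw [← hmap] at h1
      exact (integrable_map_measure (by fun_prop) hY.aemeasurable).1 h1
    · rw [mgf_gaussianReal hmap]
      apply Real.exp_le_exp.2
      have : ((Var[Y; P]).toNNReal : ℝ) ≤ (v.toNNReal : ℝ) := by
        exact_mod_cast Real.toNNReal_le_toNNReal hvar
      nlinarith [sq_nonneg t, mul_le_mul_of_nonneg_right this (sq_nonneg t)]
  have h1 := hsub.measure_ge_le hx
  have h2 := hsub.neg.measure_ge_le hx
  have hsplit : {ω | x ≤ |Y ω|} ⊆ {ω | x ≤ Y ω} ∪ {ω | x ≤ (-Y) ω} := by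
    intro ω hω
    simpa [le_abs] using hω
  rw [Real.coe_toNNReal v hv0] at h1 h2
  calc P.real {ω | x ≤ |Y ω|} ≤ P.real ({ω | x ≤ Y ω} ∪ {ω | x ≤ (-Y) ω}) :=
        measureReal_mono hsplit
    _ ≤ _ := measureReal_union_le _ _
    _ ≤ _ := by linarith

lemma tendsto_floor_mul_two_pow_div {x : ℝ} (hx : 0 ≤ x) :
    Tendsto (fun n : ℕ => (⌊2 ^ n * x⌋₊ : ℝ) / 2 ^ n) atTop (𝓝 x) := by
  have h := (tendsto_nat_floor_mul_div_atTop hx).comp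
    (tendsto_pow_atTop_atTop_of_one_lt (one_lt_two (α := ℝ)))
  simpa [Function.comp_def, mul_comm] using h

/-- Dyadic chaining: geometric control of the increments over dyadic neighbours implies
Hölder continuity. -/
lemma exists_holder_of_dyadic {f : ℝ → ℝ} (hf : ContinuousOn f (Icc 0 1)) {γ : ℝ} (hγ : 0 < γ)
    {M : ℝ} (hM : ∀ n k : ℕ, k < 2 ^ n →
      |f ((k + 1 : ℝ) / 2 ^ n) - f (k / 2 ^ n)| ≤ M * ((2 : ℝ) ^ (-γ)) ^ n) :
    ∃ K, 0 ≤ K ∧ ∀ x ∈ Icc (0 : ℝ) 1, ∀ y ∈ Icc (0 : ℝ) 1, |f x - f y| ≤ K * |x - y| ^ γ := by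
  set r : ℝ := (2 : ℝ) ^ (-γ) with hr
  have hr0 : 0 < r := by positivity
  have hr1 : r < 1 := Real.rpow_lt_one_of_one_lt_of_neg one_lt_two (by linarith)
  have hM0 : 0 ≤ M := by
    have := (abs_nonneg _).trans (hM 0 0 (by norm_num)); simpa using this
  have hstep : ∀ n j l : ℕ, l ≤ 2 ^ n → j ≤ l → l ≤ j + 1 →
      |f ((j : ℝ) / 2 ^ n) - f ((l : ℝ) / 2 ^ n)| ≤ M * r ^ n := by
    intro n j l hl hjl hlj
    rcases Nat.lt_or_ge j l with h | h
    · have : l = j + 1 := by omega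
      subst this
      rw [abs_sub_comm]
      have := hM n j (by omega)
      push_cast
      exact this
    · have : l = j := by omega
      subst this
      simp only [sub_self, abs_zero]; positivity
  have hfl : ∀ x ∈ Icc (0 : ℝ) 1, ∀ n : ℕ, ⌊2 ^ n * x⌋₊ ≤ 2 ^ n := by
    intro x hx n
    have : (2 : ℝ) ^ n * x ≤ 2 ^ n := by
      have := mul_le_mul_of_nonneg_left hx.2 (by positivity : (0 : ℝ) ≤ 2 ^ n); linarith
    calc ⌊2 ^ n * x⌋₊ ≤ ⌊(2 : ℝ) ^ n⌋₊ := Nat.floor_le_floor this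
      _ = 2 ^ n := by exact_mod_cast Nat.floor_natCast (R := ℝ) (2 ^ n)
  have happ : ∀ x ∈ Icc (0 : ℝ) 1, ∀ n : ℕ,
      |f ((⌊2 ^ n * x⌋₊ : ℝ) / 2 ^ n) - f x| ≤ M * r * r ^ n / (1 - r) := by
    intro x hx n
    have hmem : ∀ n : ℕ, (⌊2 ^ n * x⌋₊ : ℝ) / 2 ^ n ∈ Icc (0 : ℝ) 1 := by
      intro n
      refine ⟨by positivity, ?_⟩
      rw [div_le_one (by positivity)]
      exact_mod_cast hfl x hx n
    have ht : Tendsto (fun n : ℕ => f ((⌊2 ^ n * x⌋₊ : ℝ) / 2 ^ n)) atTop (𝓝 (f x)) :=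
      (hf x hx).tendsto.comp (tendsto_nhdsWithin_iff.2
        ⟨tendsto_floor_mul_two_pow_div hx.1, Eventually.of_forall hmem⟩)
    have := dist_le_of_le_geometric_of_tendsto r (M * r) hr1 (fun m => ?_) ht n
    · simpa [Real.dist_eq] using this
    -- Doubling a number at least doubles its floor and adds at most one more, so the approximations
    -- of `x` at levels `m` and `m + 1` are equal or adjacent nodes of level `m + 1`.
    · have h2 : (⌊2 ^ m * x⌋₊ : ℝ) / 2 ^ m = ((2 * ⌊2 ^ m * x⌋₊ : ℕ) : ℝ) / 2 ^ (m + 1) := by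
        push_cast; rw [pow_succ]; field_simp
      rw [Real.dist_eq, h2]
      have hx2 : (2 : ℝ) ^ (m + 1) * x = 2 * (2 ^ m * x) := by ring
      have hy0 : 0 ≤ (2 : ℝ) ^ m * x := mul_nonneg (by positivity) hx.1
      refine (hstep (m + 1) _ _ (hfl x hx (m + 1)) ?_ ?_).trans (le_of_eq (by ring))
      · apply Nat.le_floor
        rw [hx2]; push_cast
        linarith [Nat.floor_le hy0]
      · have : ⌊(2 : ℝ) ^ (m + 1) * x⌋₊ < 2 * ⌊2 ^ m * x⌋₊ + 2 := by
          rw [Nat.floor_lt (by rw [hx2]; linarith)]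
          rw [hx2]; push_cast
          linarith [Nat.lt_floor_add_one ((2 : ℝ) ^ m * x)]
        omega
  -- Two geometric tails, one for each endpoint, and one step between their approximations at the
  -- level `n` with `2^(-n-1) < |x - y| ≤ 2^(-n)`. The factor `2^γ` below is the loss in comparing
  -- `2^(-n)` with `|x - y|`.
  set K₀ : ℝ := 2 * (M * r / (1 - r)) + M with hK₀
  have hK₀0 : 0 ≤ K₀ := by
    have : 0 < 1 - r := by linarith
    positivity
  refine ⟨K₀ * 2 ^ γ, by positivity, ?_⟩
  have key : ∀ x ∈ Icc (0 : ℝ) 1, ∀ y ∈ Icc (0 : ℝ) 1, x < y →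
      |f x - f y| ≤ K₀ * 2 ^ γ * |x - y| ^ γ := by
    intro x hx y hy hxy
    have hd0 : 0 < y - x := by linarith
    have hd1 : y - x ≤ 1 := by linarith [hx.1, hy.2]
    obtain ⟨n, hn1, hn2⟩ := exists_nat_pow_near_of_lt_one hd0 hd1
      (by norm_num : (0 : ℝ) < 1 / 2) (by norm_num)
    have hn3 : (2 : ℝ) ^ n * y ≤ 2 ^ n * x + 1 := by
      have := mul_le_mul_of_nonneg_left hn2 (by positivity : (0 : ℝ) ≤ 2 ^ n)
      rw [← mul_pow] at this
      norm_num at this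
      linarith
    have hmid : |f ((⌊2 ^ n * x⌋₊ : ℝ) / 2 ^ n) - f ((⌊2 ^ n * y⌋₊ : ℝ) / 2 ^ n)| ≤ M * r ^ n := by
      refine hstep n _ _ (hfl y hy n) (Nat.floor_le_floor (by gcongr)) ?_
      have := Nat.floor_le_floor hn3
      rwa [Nat.floor_add_one (mul_nonneg (by positivity) hx.1)] at this
    have h1 := happ x hx n
    have h2 := happ y hy n
    have htri : |f x - f y| ≤ K₀ * r ^ n := by
      have e : M * r * r ^ n / (1 - r) = M * r / (1 - r) * r ^ n := by ring
      rw [e] at h1 h2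
      rw [abs_le] at *
      constructor <;> nlinarith
    refine htri.trans ?_
    rw [mul_assoc]
    gcongr
    rw [abs_sub_comm, abs_of_pos hd0]
    have : r ^ n = 2 ^ γ * ((1 / 2 : ℝ) ^ (n + 1)) ^ γ := by
      rw [hr, ← Real.rpow_natCast, ← Real.rpow_mul (by norm_num), ← Real.rpow_natCast,
        ← Real.rpow_mul (by norm_num), one_div, Real.inv_rpow (by norm_num),
        ← Real.rpow_neg (by norm_num), ← Real.rpow_add (by norm_num)]
      congr 1; push_cast; ring
    rw [this]
    gcongr
  intro x hx y hy
  rcases lt_trichotomy x y with h | h | h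
  · exact key x hx y hy h
  · subst h; simp only [sub_self, abs_zero]; positivity
  · rw [abs_sub_comm (f x), abs_sub_comm x]; exact key y hy x hx h

/-- Super-exponentially decaying terms beat any geometric growth. -/
lemma summable_geometric_mul_exp_neg {q b c : ℝ} (hq : 1 < q) (hb : 0 ≤ b) (hc : 0 < c) :
    Summable (fun n : ℕ => b ^ n * Real.exp (-(c * q ^ n))) := by
  -- With `b < q^p`, the single Taylor term `y^p / p! ≤ exp y` at `y = c q^n` already leaves a
  -- convergent geometric series.
  obtain ⟨p, hp⟩ := pow_unbounded_of_one_lt b hq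
  have hq0 : 0 < q := by linarith
  have hs : Summable (fun n : ℕ => (p.factorial : ℝ) / c ^ p * (b / q ^ p) ^ n) :=
    (summable_geometric_of_lt_one (by positivity) ((div_lt_one (by positivity)).2 hp)).mul_left _
  refine hs.of_nonneg_of_le (fun n => by positivity) (fun n => ?_)
  have h := Real.pow_div_factorial_le_exp (c * q ^ n) (by positivity) p
  rw [Real.exp_neg, div_pow]
  have h0 : 0 < (c * q ^ n) ^ p / (p.factorial : ℝ) := by positivity
  calc b ^ n * (Real.exp (c * q ^ n))⁻¹ ≤ b ^ n * ((c * q ^ n) ^ p / (p.factorial : ℝ))⁻¹ := by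
        gcongr
    _ = _ := by
        rw [mul_pow, ← pow_mul, ← pow_mul, inv_div, mul_comm n p]; field_simp

/-- Borel-Cantelli with a summable real bound. -/
lemma ae_eventually_notMem_of_summable {Ω : Type*} {mΩ : MeasurableSpace Ω} {P : Measure Ω}
    [IsProbabilityMeasure P] {E : ℕ → Set Ω} {b : ℕ → ℝ} (hb : Summable b)
    (h : ∀ n, P.real (E n) ≤ b n) : ∀ᵐ ω ∂P, ∀ᶠ n in atTop, ω ∉ E n := by
  -- No measurability of the events is needed. This matters later, where they involve an uncountable
  -- supremum of a path.
  refine ae_eventually_notMem (ne_top_of_le_ne_top hb.tsum_ofReal_ne_top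
    (ENNReal.tsum_le_tsum fun n => ?_))
  rw [← ofReal_measureReal]
  exact ENNReal.ofReal_le_ofReal (h n)

/-- **Kolmogorov continuity** for Gaussian increments: an a.s. continuous process on `[A,B]` with
centered Gaussian increments of variance at most `C |s-r|^{2α}` is a.s. Hölder of all orders
`γ < α`. -/
lemma ae_exists_holder {Ω : Type*} {mΩ : MeasurableSpace Ω} {P : Measure Ω}
    [IsProbabilityMeasure P] {X : ℝ → Ω → ℝ} {A B α C γ : ℝ} (hAB : A < B) (hγ : 0 < γ)
    (hγα : γ < α)
    (hcont : ∀ᵐ ω ∂P, ContinuousOn (fun t => X t ω) (Icc A B))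
    (hgauss : ∀ s ∈ Icc A B, ∀ r ∈ Icc A B, HasGaussianLaw (fun ω => X s ω - X r ω) P)
    (hmean : ∀ s ∈ Icc A B, ∀ r ∈ Icc A B, ∫ ω, X s ω - X r ω ∂P = 0)
    (hvar : ∀ s ∈ Icc A B, ∀ r ∈ Icc A B, r ≤ s →
      ∫ ω, (X s ω - X r ω) ^ 2 ∂P ≤ C * (s - r) ^ (2 * α)) :
    ∀ᵐ ω ∂P, ∃ K, 0 ≤ K ∧ ∀ s ∈ Icc A B, ∀ r ∈ Icc A B,
      |X s ω - X r ω| ≤ K * |s - r| ^ γ := by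
  set l : ℝ := B - A with hl
  have hl0 : 0 < l := by linarith
  set C' : ℝ := (|C| + 1) * l ^ (2 * α) with hC'
  have hC'0 : 0 < C' := by positivity
  set p : ℕ → ℕ → ℝ := fun n k => A + l * ((k : ℝ) / 2 ^ n) with hp
  have hmem : ∀ n k : ℕ, k ≤ 2 ^ n → p n k ∈ Icc A B := by
    intro n k hk
    have h1 : (k : ℝ) / 2 ^ n ≤ 1 := by
      rw [div_le_one (by positivity)]; exact_mod_cast hk
    have h2 : 0 ≤ (k : ℝ) / 2 ^ n := by positivity
    constructor
    · have := mul_nonneg hl0.le h2; simp only [hp]; linarith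
    · have := mul_le_mul_of_nonneg_left h1 hl0.le; simp only [hp]; linarith
  set r : ℝ := (2 : ℝ) ^ (-γ) with hr
  have hr0 : 0 < r := by positivity
  -- Ratio per level of the squared threshold `2^(-2γn)` to the variance `2^(-2αn)`. It exceeds 1
  -- because `γ < α`, which beats the `2^n` increments of level `n`.
  set q : ℝ := (2 : ℝ) ^ (2 * (α - γ)) with hq
  have hq1 : 1 < q := Real.one_lt_rpow one_lt_two (by linarith)
  have hone : ∀ n k : ℕ, k < 2 ^ n →
      P.real {ω | r ^ n ≤ |X (p n (k + 1)) ω - X (p n k) ω|} ≤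
        2 * Real.exp (-(1 / (2 * C') * q ^ n)) := by
    intro n k hk
    have m1 := hmem n (k + 1) hk
    have m0 := hmem n k hk.le
    have hdiff : p n (k + 1) - p n k = l * (1 / 2) ^ n := by
      simp only [hp]; push_cast; rw [one_div, inv_pow]; ring
    have hle : p n k ≤ p n (k + 1) := by
      have : 0 ≤ l * (1 / 2) ^ n := by positivity
      linarith
    have hv := hvar _ m1 _ m0 hle
    rw [hdiff, Real.mul_rpow hl0.le (by positivity)] at hv
    have hv' : ∫ ω, (X (p n (k + 1)) ω - X (p n k) ω) ^ 2 ∂P ≤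
        C' * ((1 / 2 : ℝ) ^ n) ^ (2 * α) := by
      refine hv.trans ?_
      rw [hC', ← mul_assoc]
      gcongr
      linarith [le_abs_self C]
    have := measureReal_abs_ge_le_of_hasGaussianLaw (hgauss _ m1 _ m0) (hmean _ m1 _ m0) hv'
      (pow_nonneg hr0.le n)
    refine this.trans (le_of_eq ?_)
    congr 2
    have e : (r ^ n) ^ 2 / ((1 / 2 : ℝ) ^ n) ^ (2 * α) = q ^ n := by
      rw [hr, hq, one_div, inv_pow, Real.inv_rpow (by positivity), div_inv_eq_mul,
        ← Real.rpow_natCast (2 : ℝ) n, ← Real.rpow_mul zero_le_two,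
        ← Real.rpow_mul_natCast zero_le_two, ← Real.rpow_mul_natCast zero_le_two,
        ← Real.rpow_mul_natCast zero_le_two, ← Real.rpow_add zero_lt_two]
      congr 1; push_cast; ring
    rw [← e]; field_simp
  set E : ℕ → Set Ω := fun n =>
    ⋃ k ∈ Finset.range (2 ^ n), {ω | r ^ n ≤ |X (p n (k + 1)) ω - X (p n k) ω|} with hE
  have hEle : ∀ n, P.real (E n) ≤ 2 * (2 ^ n * Real.exp (-(1 / (2 * C') * q ^ n))) := by
    intro n
    refine (measureReal_biUnion_finset_le _ _).trans ?_
    refine (Finset.sum_le_sum (fun k hk => hone n k (Finset.mem_range.1 hk))).trans ?_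
    simp; ring_nf; rfl
  have hs := (summable_geometric_mul_exp_neg hq1 (zero_le_two (α := ℝ))
    (by positivity : 0 < 1 / (2 * C'))).mul_left 2
  filter_upwards [hcont, ae_eventually_notMem_of_summable hs hEle] with ω hω hev
  obtain ⟨N, hN⟩ := eventually_atTop.1 hev
  -- The finitely many levels below `N`, where nothing is controlled, are absorbed by adding all
  -- their normalised increments to the constant.
  have hinc : ∀ n k : ℕ, k < 2 ^ n → |X (p n (k + 1)) ω - X (p n k) ω| ≤
      (1 + ∑ n ∈ Finset.range N, ∑ k ∈ Finset.range (2 ^ n),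
        |X (p n (k + 1)) ω - X (p n k) ω| / r ^ n) * r ^ n := by
    intro n k hk
    have hS0 : ∀ n, 0 ≤ ∑ k ∈ Finset.range (2 ^ n), |X (p n (k + 1)) ω - X (p n k) ω| / r ^ n :=
      fun n => Finset.sum_nonneg (fun k _ => by positivity)
    rcases le_or_gt N n with h | h
    · have h3 := hN n h
      simp only [hE, Set.mem_iUnion, Set.mem_ofPred_eq, not_exists, not_le, Finset.mem_range] at h3
      have h4 := Finset.sum_nonneg (fun n (_ : n ∈ Finset.range N) => hS0 n)
      have h5 := h3 k hk
      have : 0 < r ^ n := by positivity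
      nlinarith
    · rw [← div_le_iff₀ (by positivity)]
      have h3 := Finset.single_le_sum (fun n _ => hS0 n) (Finset.mem_range.2 h)
      have h4 := Finset.single_le_sum
        (f := fun k => |X (p n (k + 1)) ω - X (p n k) ω| / r ^ n)
        (fun k _ => by positivity) (Finset.mem_range.2 hk)
      linarith
  have hmaps : MapsTo (fun x : ℝ => A + l * x) (Icc 0 1) (Icc A B) := by
    intro x hx
    constructor
    · have := mul_nonneg hl0.le hx.1; simp only; linarith
    · have := mul_le_mul_of_nonneg_left hx.2 hl0.le; simp only; linarith
  have hfc : ContinuousOn (fun x => X (A + l * x) ω) (Icc 0 1) :=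
    hω.comp (by fun_prop) hmaps
  obtain ⟨K, hK0, hK⟩ := exists_holder_of_dyadic hfc hγ (M := _) (fun n k hk => by
    have := hinc n k hk
    simp only [hp] at this
    push_cast at this
    exact this)
  refine ⟨K * (l ^ γ)⁻¹, by positivity, fun s hs u hu => ?_⟩
  have hinv : ∀ s ∈ Icc A B, (s - A) / l ∈ Icc (0 : ℝ) 1 ∧ A + l * ((s - A) / l) = s := by
    intro s hs
    refine ⟨⟨div_nonneg (by linarith [hs.1]) hl0.le, ?_⟩, by field_simp; ring⟩
    rw [div_le_one hl0]; linarith [hs.2]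
  have := hK _ (hinv s hs).1 _ (hinv u hu).1
  rw [(hinv s hs).2, (hinv u hu).2] at this
  refine this.trans (le_of_eq ?_)
  have e : (s - A) / l - (u - A) / l = (s - u) / l := by ring
  rw [e, abs_div, abs_of_pos hl0, Real.div_rpow (abs_nonneg _) hl0.le]
  ring

end Holder

/-! ### Explicit integrals of powers and the Beta integral. -/

section PowerIntegrals

lemma integrableOn_sub_rpow {a b p : ℝ} (hp : -1 < p) :
    IntegrableOn (fun x => (x - a) ^ p) (Ioo a b) := by
  rcases le_or_gt b a with h | h
  · simp [Ioo_eq_empty_of_le h]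
  have h1 : IntervalIntegrable (fun x : ℝ => x ^ p) volume (a - a) (b - a) :=
    intervalIntegral.intervalIntegrable_rpow' hp
  have h2 := (h1.comp_sub_right a)
  simp only [sub_add_cancel] at h2
  exact ((intervalIntegrable_iff_integrableOn_Ioo_of_le h.le).1 h2)

lemma integrableOn_rsub_rpow {a b p : ℝ} (hp : -1 < p) :
    IntegrableOn (fun x => (b - x) ^ p) (Ioo a b) := by
  rcases le_or_gt b a with h | h
  · simp [Ioo_eq_empty_of_le h]
  have h1 : IntervalIntegrable (fun x : ℝ => x ^ p) volume (b - b) (b - a) :=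
    intervalIntegral.intervalIntegrable_rpow' hp
  have h2 := (h1.comp_sub_left b)
  simp only [sub_sub_cancel] at h2
  exact ((intervalIntegrable_iff_integrableOn_Ioo_of_le h.le).1 h2.symm)

lemma integral_sub_rpow {a b p : ℝ} (hab : a ≤ b) (hp : -1 < p) :
    ∫ x in Ioo a b, (x - a) ^ p = (b - a) ^ (p + 1) / (p + 1) := by
  rw [← integral_Ioc_eq_integral_Ioo, ← intervalIntegral.integral_of_le hab,
    intervalIntegral.integral_comp_sub_right (fun x => x ^ p), integral_rpow (Or.inl hp), sub_self,
    Real.zero_rpow (by linarith), sub_zero]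

lemma integral_Ioc_rsub_rpow_of_lt {β p q s : ℝ} (hβ : 0 < β) (hpq : p ≤ q) (hqs : q < s) :
    ∫ u in Ioc p q, (s - u) ^ (-(β + 1)) = ((s - q) ^ (-β) - (s - p) ^ (-β)) / β := by
  rw [← intervalIntegral.integral_of_le hpq,
    intervalIntegral.integral_comp_sub_left (fun x => x ^ (-(β + 1))), integral_rpow]
  · have : -(β + 1) + 1 = -β := by ring
    rw [this]; field_simp; ring
  · right
    refine ⟨by linarith, ?_⟩
    rw [uIcc_of_le (by linarith)]
    intro h; linarith [h.1]

lemma integrableOn_Ioc_rsub_rpow_of_lt {r p q s : ℝ} (hqs : q < s) :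
    IntegrableOn (fun u => (s - u) ^ r) (Ioc p q) := by
  refine (ContinuousOn.integrableOn_Icc ?_).mono_set Ioc_subset_Icc_self
  intro u hu
  exact (ContinuousAt.rpow_const (by fun_prop)
    (Or.inl (by linarith [hu.2]))).continuousWithinAt

lemma integral_shifted_rpow {β e s t : ℝ} (hβ1 : β < 1) (he : 0 < e) (hst : s ≤ t) :
    ∫ u in Ioo s t, (u - s + e) ^ (β - 2) =
      (e ^ (β - 1) - (t - s + e) ^ (β - 1)) / (1 - β) := by
  have h : ∀ u : ℝ, u - s + e = u - (s - e) := fun u => by ring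
  simp_rw [h]
  rw [← integral_Ioc_eq_integral_Ioo, ← intervalIntegral.integral_of_le hst,
    intervalIntegral.integral_comp_sub_right (fun x => x ^ (β - 2)), integral_rpow]
  · have : β - 2 + 1 = -(1 - β) := by ring
    have h1 : (1 - β) ≠ 0 := by linarith
    have h2 : s - (s - e) = e := by ring
    have h3 : β - 1 = -(1 - β) := by ring
    rw [this, h2, h3]; field_simp; ring
  · right
    refine ⟨by linarith, ?_⟩
    rw [uIcc_of_le (by linarith)]
    intro h; linarith [h.1]

lemma integrableOn_sub_rpow_mul_shifted {β e a u : ℝ} (hβ1 : β < 1) (he : 0 < e) :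
    IntegrableOn (fun s => (s - a) ^ (-β) * (u - s + e) ^ (β - 2)) (Ioo a u) := by
  refine Integrable.mono' ((integrableOn_sub_rpow (a := a) (b := u)
    (by linarith : -1 < -β)).mul_const (e ^ (β - 2))) (by fun_prop) ?_
  refine ae_restrict_of_forall_mem measurableSet_Ioo (fun s hs => ?_)
  have h1 : 0 < s - a := by linarith [hs.1]
  have h2 : e ≤ u - s + e := by linarith [hs.2]
  have h3 : 0 < u - s + e := by linarith
  rw [Real.norm_of_nonneg (by positivity)]
  gcongr 1
  exact Real.rpow_le_rpow_of_nonpos he h2 (by linarith)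

/-- The Möbius map `s ↦ (s - a) / (u - s + e)` has derivative `(u - a + e) / (u - s + e)²`, so its
power `1 - β` is an antiderivative up to a constant. -/
lemma integral_sub_rpow_mul_shifted {β e a u : ℝ} (hβ1 : β < 1) (he : 0 < e)
    (hau : a ≤ u) :
    ∫ s in Ioo a u, (s - a) ^ (-β) * (u - s + e) ^ (β - 2) =
      ((u - a) / e) ^ (1 - β) / ((1 - β) * (u - a + e)) := by
  have hβ' : 1 - β ≠ 0 := by linarith
  have hc : 0 < u - a + e := by linarith
  have hint : IntervalIntegrable (fun s => (s - a) ^ (-β) * (u - s + e) ^ (β - 2)) volume a u :=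
    (intervalIntegrable_iff_integrableOn_Ioo_of_le hau).2
      (integrableOn_sub_rpow_mul_shifted hβ1 he)
  rw [← integral_Ioc_eq_integral_Ioo, ← intervalIntegral.integral_of_le hau]
  rw [intervalIntegral.integral_eq_sub_of_hasDerivAt_of_le
    (f := fun s => ((s - a) / (u - s + e)) ^ (1 - β) / ((1 - β) * (u - a + e))) hau ?_ ?_ hint]
  · simp [Real.zero_rpow hβ']
  · intro s hs
    have : u - s + e ≠ 0 := by linarith [hs.2]
    refine ContinuousWithinAt.div_const ?_ _
    refine ContinuousWithinAt.rpow_const ?_ (Or.inr (by linarith))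
    exact ContinuousAt.continuousWithinAt (by fun_prop (disch := assumption))
  · intro s hs
    have h1 : 0 < s - a := by linarith [hs.1]
    have h3 : 0 < u - s + e := by linarith [hs.2]
    have hd : HasDerivAt (fun s : ℝ => (s - a) / (u - s + e))
        ((1 * (u - s + e) - (s - a) * (-1)) / (u - s + e) ^ 2) s := by
      refine HasDerivAt.div ((hasDerivAt_id s).sub_const a) ?_ h3.ne'
      exact ((hasDerivAt_id s).const_sub u).add_const e
    have h4 := (hd.rpow_const (p := 1 - β) (Or.inl (by positivity))).div_const
      ((1 - β) * (u - a + e))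
    refine h4.congr_deriv ?_
    have e1 : 1 - β - 1 = -β := by ring
    have e2 : (u - s + e) ^ (β - 2) = (u - s + e) ^ β / (u - s + e) ^ 2 := by
      rw [Real.rpow_sub h3]; norm_num
    rw [e1, e2, Real.div_rpow h1.le h3.le, Real.rpow_neg h3.le]
    field_simp
    ring

/-- Each half of the interval contains only one singularity; there the other factor is bounded by
its value at distance `d`, half the length. -/
lemma integrableOn_beta {a t β : ℝ} (h0 : 0 < β) (h1 : β < 1) :
    IntegrableOn (fun s => (s - a) ^ (-β) * (t - s) ^ (β - 1)) (Ioo a t) := by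
  rcases le_or_gt t a with h | h
  · simp [Ioo_eq_empty_of_le h]
  set d := (t - a) / 2 with hd
  have hd0 : 0 < d := by simp only [hd]; linarith
  refine Integrable.mono' (((integrableOn_sub_rpow (a := a) (b := t)
    (by linarith : -1 < -β)).mul_const (d ^ (β - 1))).add
    ((integrableOn_rsub_rpow (a := a) (b := t)
    (by linarith : -1 < β - 1)).const_mul (d ^ (-β)))) (by fun_prop) ?_
  refine ae_restrict_of_forall_mem measurableSet_Ioo (fun s hs => ?_)
  have h2 : 0 < s - a := by linarith [hs.1]
  have h3 : 0 < t - s := by linarith [hs.2]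
  rw [Real.norm_of_nonneg (by positivity)]
  simp only [Pi.add_apply]
  rcases le_total (s - a) d with h | h
  · have : d ≤ t - s := by simp only [hd] at *; linarith
    have := Real.rpow_le_rpow_of_nonpos hd0 this (by linarith : β - 1 ≤ 0)
    have := mul_le_mul_of_nonneg_left this (by positivity : 0 ≤ (s - a) ^ (-β))
    have : 0 ≤ d ^ (-β) * (t - s) ^ (β - 1) := by positivity
    linarith
  · have := Real.rpow_le_rpow_of_nonpos hd0 h (by linarith : -β ≤ 0)
    have := mul_le_mul_of_nonneg_right this (by positivity : 0 ≤ (t - s) ^ (β - 1))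
    have : 0 ≤ (s - a) ^ (-β) * d ^ (β - 1) := by positivity
    linarith

/-- The exponents of the Beta integral add up to 1, so the power of the length produced by scaling
is trivial and the value does not depend on `t - a`. -/
lemma integral_beta {a t β : ℝ} (h0 : 0 < β) (h1 : β < 1) (hat : a < t) :
    ∫ s in Ioo a t, (s - a) ^ (-β) * (t - s) ^ (β - 1) =
      Real.Gamma β * Real.Gamma (1 - β) := by
  have hL : 0 < t - a := by linarith
  have hc := Complex.betaIntegral_scaled ((1 - β : ℝ) : ℂ) (β : ℂ) hL
  rw [Complex.betaIntegral_eq_Gamma_mul_div _ _ (by simpa using h1) (by simpa using h0),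
    ← Complex.ofReal_add, Complex.Gamma_ofReal, Complex.Gamma_ofReal] at hc
  simp only [sub_add_cancel, Complex.ofReal_one, sub_self, Complex.cpow_zero, one_mul,
    Complex.Gamma_one, div_one] at hc
  rw [← integral_Ioc_eq_integral_Ioo, ← intervalIntegral.integral_of_le hat.le]
  have hs := intervalIntegral.integral_comp_sub_right (a := a) (b := t)
    (fun x : ℝ => x ^ (-β) * (t - a - x) ^ (β - 1)) a
  simp only [sub_self] at hs
  have e : ∀ s : ℝ, t - a - (s - a) = t - s := fun s => by ring
  simp only [e] at hs
  rw [hs]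
  have hr : ((∫ x in (0 : ℝ)..(t - a), x ^ (-β) * (t - a - x) ^ (β - 1) : ℝ) : ℂ) =
      ∫ x in (0 : ℝ)..(t - a), (x : ℂ) ^ (((1 - β : ℝ) : ℂ) - 1) *
        (((t - a : ℝ) : ℂ) - x) ^ ((β : ℂ) - 1) := by
    rw [← intervalIntegral.integral_ofReal]
    refine intervalIntegral.integral_congr (fun x hx => ?_)
    rw [uIcc_of_le hL.le] at hx
    simp only [Complex.ofReal_mul]
    rw [Complex.ofReal_cpow hx.1, Complex.ofReal_cpow (by linarith [hx.2])]
    push_cast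
    ring_nf
  have := hr.trans hc
  rw [mul_comm (Real.Gamma β)]
  exact_mod_cast this

end PowerIntegrals

/-! ### Inversion of the right-sided Weyl derivative by regularising the kernel. -/

section Inversion

lemma setIntegral_Ioo_indicator_Ioi {a s t : ℝ} (has : a ≤ s) (f : ℝ → ℝ) :
    ∫ u in Ioo a t, (Ioi s).indicator f u = ∫ u in Ioo s t, f u := by
  rw [setIntegral_indicator measurableSet_Ioi]
  congr 2
  ext u; simp only [mem_inter_iff, mem_Ioo, mem_Ioi]
  constructor
  · rintro ⟨h1, h2⟩; exact ⟨h2, h1.2⟩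
  · rintro ⟨h1, h2⟩; exact ⟨⟨by linarith, h2⟩, h1⟩

lemma setIntegral_Ioo_indicator_Iio {a u t : ℝ} (hut : u ≤ t) (f : ℝ → ℝ) :
    ∫ s in Ioo a t, (Iio u).indicator f s = ∫ s in Ioo a u, f s := by
  rw [setIntegral_indicator measurableSet_Iio]
  congr 2
  ext s; simp only [mem_inter_iff, mem_Ioo, mem_Iio]
  constructor
  · rintro ⟨h1, h2⟩; exact ⟨h1.1, h2⟩
  · rintro ⟨h1, h2⟩; exact ⟨⟨h1, by linarith⟩, h2⟩

/-- The open half plane `{(s,u) | s < u}`. -/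
def upperHalf : Set (ℝ × ℝ) := {p | p.1 < p.2}

lemma measurableSet_upperHalf : MeasurableSet upperHalf :=
  measurableSet_lt measurable_fst measurable_snd

lemma upperHalf_indicator_left (f : ℝ × ℝ → ℝ) (s : ℝ) :
    (fun u => upperHalf.indicator f (s, u)) = (Ioi s).indicator (fun u => f (s, u)) := by
  rfl

lemma upperHalf_indicator_right (f : ℝ × ℝ → ℝ) (u : ℝ) :
    (fun s => upperHalf.indicator f (s, u)) = (Iio u).indicator (fun s => f (s, u)) := by
  rfl

/-- Integrable majorant for the Weyl double integral: a Hölder bound of order `γ` turns `(u -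
s)^(β-2)` into `(u - s)^(δ-1)` with `δ = γ + β - 1`. The inner integral in `u` is then bounded, and
what remains is integrable since `β < 1`. -/
lemma integrable_triangle {a t β δ : ℝ} (h1 : β < 1) (hδ : 0 < δ) :
    Integrable (upperHalf.indicator
      (fun p : ℝ × ℝ => (p.1 - a) ^ (-β) * (p.2 - p.1) ^ (δ - 1)))
      ((volume.restrict (Ioo a t)).prod (volume.restrict (Ioo a t))) := by
  have hmeas : Measurable (upperHalf.indicator
      (fun p : ℝ × ℝ => (p.1 - a) ^ (-β) * (p.2 - p.1) ^ (δ - 1))) :=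
    Measurable.indicator (by fun_prop) measurableSet_upperHalf
  rw [integrable_prod_iff hmeas.aestronglyMeasurable]
  constructor
  · refine ae_restrict_of_forall_mem measurableSet_Ioo (fun s hs => ?_)
    rw [upperHalf_indicator_left]
    rw [integrable_indicator_iff measurableSet_Ioi, IntegrableOn,
      Measure.restrict_restrict measurableSet_Ioi]
    refine IntegrableOn.mono_set (t := Ioo s t) ?_ (fun u hu => ⟨hu.1, hu.2.2⟩)
    exact Integrable.const_mul (integrableOn_sub_rpow (a := s) (b := t)
      (by linarith : -1 < δ - 1)) ((s - a) ^ (-β))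
  · have hb := (integrableOn_sub_rpow (a := a) (b := t)
      (by linarith : -1 < -β)).mul_const ((t - a) ^ δ / δ)
    refine Integrable.mono' hb
      (hmeas.norm.stronglyMeasurable.integral_prod_right').aestronglyMeasurable ?_
    refine ae_restrict_of_forall_mem measurableSet_Ioo (fun s hs => ?_)
    have h2 : 0 < s - a := by linarith [hs.1]
    have h3 : 0 < t - s := by linarith [hs.2]
    rw [Real.norm_of_nonneg (integral_nonneg fun u => norm_nonneg _)]
    have : (fun u => ‖upperHalf.indicator
        (fun p : ℝ × ℝ => (p.1 - a) ^ (-β) * (p.2 - p.1) ^ (δ - 1)) (s, u)‖) =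
        (Ioi s).indicator (fun u => (s - a) ^ (-β) * (u - s) ^ (δ - 1)) := by
      ext u
      by_cases h : s < u
      · have : 0 < u - s := by linarith
        rw [indicator_of_mem (show (s, u) ∈ upperHalf from h), indicator_of_mem (mem_Ioi.2 h),
          Real.norm_of_nonneg (by positivity)]
      · rw [indicator_of_notMem (show (s, u) ∉ upperHalf from h), indicator_of_notMem (by simpa using h),
          norm_zero]
    rw [this, setIntegral_Ioo_indicator_Ioi hs.1.le, integral_const_mul,
      integral_sub_rpow hs.2.le (by linarith), sub_add_cancel]
    gcongr
    exact hs.1.le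

/-- The regularised double integral in closed form. -/
lemma integral_regularised {a t β e : ℝ} {G : ℝ → ℝ} (hG : Continuous G)
    (h1 : β < 1) (he : 0 < e) :
    (1 - β) * ∫ p, upperHalf.indicator (fun p : ℝ × ℝ =>
        (p.1 - a) ^ (-β) * ((G p.1 - G p.2) * (p.2 - p.1 + e) ^ (β - 2))) p
      ∂((volume.restrict (Ioo a t)).prod (volume.restrict (Ioo a t))) =
    ∫ s in Ioo a t, G s * (s - a) ^ (-β) * (e ^ β / (s - a + e) - (t - s + e) ^ (β - 1)) := by
  set μ := volume.restrict (Ioo a t)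
  obtain ⟨M, hM⟩ : ∃ M, ∀ s ∈ Icc a t, |G s| ≤ M :=
    isCompact_Icc.exists_bound_of_continuousOn hG.continuousOn
  have hM' : ∀ s ∈ Ioo a t, |G s| ≤ M := fun s hs => hM s (Ioo_subset_Icc_self hs)
  set A : ℝ × ℝ → ℝ := fun p => (p.1 - a) ^ (-β) * (G p.1 * (p.2 - p.1 + e) ^ (β - 2)) with hA
  set B : ℝ × ℝ → ℝ := fun p => (p.1 - a) ^ (-β) * (G p.2 * (p.2 - p.1 + e) ^ (β - 2)) with hB
  have hae : ∀ᵐ p ∂(μ.prod μ), p ∈ Ioo a t ×ˢ Ioo a t := by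
    rw [Measure.prod_restrict]
    exact ae_restrict_mem (measurableSet_Ioo.prod measurableSet_Ioo)
  have hdom : Integrable (fun p : ℝ × ℝ => (p.1 - a) ^ (-β) * (M * e ^ (β - 2))) (μ.prod μ) :=
    (integrableOn_sub_rpow (a := a) (b := t) (by linarith : -1 < -β)).mul_prod
      (ν := μ) (integrable_const (M * e ^ (β - 2)))
  have hint : ∀ π : ℝ × ℝ → ℝ, Measurable π → (∀ p ∈ Ioo a t ×ˢ Ioo a t, |π p| ≤ M) →
      Integrable (upperHalf.indicator
        (fun p => (p.1 - a) ^ (-β) * (π p * (p.2 - p.1 + e) ^ (β - 2)))) (μ.prod μ) := by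
    intro π hπ hπM
    refine hdom.mono' (Measurable.indicator (by fun_prop)
      measurableSet_upperHalf).aestronglyMeasurable ?_
    filter_upwards [hae] with p hp
    have h2 : 0 < p.1 - a := by linarith [hp.1.1]
    have hM0 : 0 ≤ M := (abs_nonneg _).trans (hπM p hp)
    simp only [indicator]
    split_ifs with h
    · have h4 : p.1 < p.2 := h
      have h3 : e ≤ p.2 - p.1 + e := by linarith
      have h5 : 0 < p.2 - p.1 + e := by linarith
      rw [norm_mul, norm_mul, Real.norm_of_nonneg (by positivity),
        Real.norm_of_nonneg (Real.rpow_nonneg h5.le _)]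
      gcongr ?_ * (?_ * ?_)
      · exact hπM p hp
      · exact Real.rpow_le_rpow_of_nonpos he h3 (by linarith)
    · rw [norm_zero]; positivity
  -- For `e > 0` the terms with `G s` and with `G u` are separately integrable, which fails to be
  -- available at `e = 0`. Fubini integrates the first over `u` and the second over `s`, so that
  -- both become single integrals against `G`.
  have hAi := hint (fun p => G p.1) (by fun_prop) (fun p hp => hM' _ hp.1)
  have hBi := hint (fun p => G p.2) (by fun_prop) (fun p hp => hM' _ hp.2)
  have hsub : (fun p => upperHalf.indicator (fun p : ℝ × ℝ =>
        (p.1 - a) ^ (-β) * ((G p.1 - G p.2) * (p.2 - p.1 + e) ^ (β - 2))) p) =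
      fun p => upperHalf.indicator A p - upperHalf.indicator B p := by
    ext p
    simp only [indicator, hA, hB]
    split_ifs <;> ring
  have hAin : ∀ s ∈ Ioo a t, ∫ u, upperHalf.indicator A (s, u) ∂μ =
      (s - a) ^ (-β) * (G s * ((e ^ (β - 1) - (t - s + e) ^ (β - 1)) / (1 - β))) := by
    intro s hs
    rw [upperHalf_indicator_left, setIntegral_Ioo_indicator_Ioi hs.1.le]
    simp only [hA]
    rw [integral_const_mul, integral_const_mul, integral_shifted_rpow h1 he hs.2.le]
  have hBin : ∀ u ∈ Ioo a t, ∫ s, upperHalf.indicator B (s, u) ∂μ =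
      G u * (((u - a) / e) ^ (1 - β) / ((1 - β) * (u - a + e))) := by
    intro u hu
    rw [upperHalf_indicator_right, setIntegral_Ioo_indicator_Iio hu.2.le]
    simp only [hB]
    rw [← integral_sub_rpow_mul_shifted h1 he hu.1.le, ← integral_const_mul]
    congr 1; ext s; ring
  have hAi1 : Integrable (fun s => ∫ u, upperHalf.indicator A (s, u) ∂μ) μ :=
    hAi.integral_prod_left
  have hBi1 : Integrable (fun u => ∫ s, upperHalf.indicator B (s, u) ∂μ) μ :=
    hBi.integral_prod_right
  rw [hsub, integral_sub hAi hBi, integral_prod _ hAi, integral_prod_symm _ hBi,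
    ← integral_sub hAi1 hBi1, ← integral_const_mul]
  refine setIntegral_congr_fun measurableSet_Ioo (fun s hs => ?_)
  rw [hAin s hs, hBin s hs]
  have h2 : 0 < s - a := by linarith [hs.1]
  have h3 : 1 - β ≠ 0 := by linarith
  have e1 : e ^ (β - 1) = e ^ β / e := by rw [Real.rpow_sub he, Real.rpow_one]
  have e2 : ((s - a) / e) ^ (1 - β) = (s - a) * (s - a) ^ (-β) * (e ^ β / e) := by
    rw [Real.div_rpow h2.le he.le, sub_eq_add_neg 1 β, Real.rpow_add h2, Real.rpow_add he,
      Real.rpow_one, Real.rpow_one, Real.rpow_neg he.le]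
    field_simp
  rw [e1, e2]
  field_simp
  ring

/-- Inversion of the right-sided Weyl derivative at a zero of the integrand. -/
lemma integral_weyl_eq_zero {a t β γ K : ℝ} {G : ℝ → ℝ} (hG : Continuous G)
    (h0 : 0 < β) (h1 : β < 1) (hγ : 1 - β < γ) (hat : a < t)
    (hK : ∀ s ∈ Icc a t, ∀ r ∈ Icc a t, |G s - G r| ≤ K * |s - r| ^ γ) (hGa : G a = 0) :
    ∫ s in Ioo a t, (s - a) ^ (-β) * (G s / (t - s) ^ (1 - β) +
      (1 - β) * ∫ u in Ioo s t, (G s - G u) / (u - s) ^ ((1 - β) + 1)) = 0 := by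
  set μ := volume.restrict (Ioo a t)
  set δ := γ + β - 1 with hδ
  have hδ0 : 0 < δ := by simp only [hδ]; linarith
  have hγ0 : 0 < γ := by linarith
  have hK0 : 0 ≤ K := by
    have := (abs_nonneg _).trans (hK t ⟨hat.le, le_rfl⟩ a ⟨le_rfl, hat.le⟩)
    have h2 : 0 < |t - a| ^ γ := Real.rpow_pos_of_pos (abs_pos.2 (by linarith)) _
    by_contra hneg
    push Not at hneg
    nlinarith
  set e : ℕ → ℝ := fun n => 1 / ((n : ℝ) + 1) with he
  have he0 : ∀ n, 0 < e n := fun n => by positivity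
  have het : Tendsto e atTop (𝓝 0) := tendsto_one_div_add_atTop_nhds_zero_nat
  set Φ : ℝ → ℝ × ℝ → ℝ := fun ε => upperHalf.indicator (fun p : ℝ × ℝ =>
        (p.1 - a) ^ (-β) * ((G p.1 - G p.2) * (p.2 - p.1 + ε) ^ (β - 2))) with hΦ
  have hΦm : ∀ ε, Measurable (Φ ε) := fun ε =>
    Measurable.indicator (by fun_prop) measurableSet_upperHalf
  have hae : ∀ᵐ p ∂(μ.prod μ), p ∈ Ioo a t ×ˢ Ioo a t := by
    rw [Measure.prod_restrict]
    exact ae_restrict_mem (measurableSet_Ioo.prod measurableSet_Ioo)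
  have hdom := (integrable_triangle (a := a) (t := t) h1 hδ0).const_mul K
  have hbd : ∀ ε, 0 ≤ ε → ∀ᵐ p ∂(μ.prod μ), ‖Φ ε p‖ ≤ K * upperHalf.indicator
      (fun p : ℝ × ℝ => (p.1 - a) ^ (-β) * (p.2 - p.1) ^ (δ - 1)) p := by
    intro ε hε
    filter_upwards [hae] with p hp
    have h2 : 0 < p.1 - a := by linarith [hp.1.1]
    simp only [hΦ, indicator]
    split_ifs with h
    · have h4 : p.1 < p.2 := h
      have h5 : 0 < p.2 - p.1 := by linarith
      rw [norm_mul, norm_mul, Real.norm_of_nonneg (by positivity),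
        Real.norm_of_nonneg (Real.rpow_nonneg (by linarith : 0 ≤ p.2 - p.1 + ε) _)]
      have h6 := hK p.1 (Ioo_subset_Icc_self hp.1) p.2 (Ioo_subset_Icc_self hp.2)
      rw [abs_sub_comm p.1, abs_of_pos h5] at h6
      have h7 : (p.2 - p.1 + ε) ^ (β - 2) ≤ (p.2 - p.1) ^ (β - 2) :=
        Real.rpow_le_rpow_of_nonpos h5 (by linarith) (by linarith)
      calc (p.1 - a) ^ (-β) * (‖G p.1 - G p.2‖ * (p.2 - p.1 + ε) ^ (β - 2))
          ≤ (p.1 - a) ^ (-β) * ((K * (p.2 - p.1) ^ γ) * (p.2 - p.1) ^ (β - 2)) := by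
            gcongr
            exact h6
        _ = _ := by
          have : δ - 1 = γ + (β - 2) := by simp only [hδ]; ring
          rw [this, Real.rpow_add h5]; ring
    · simp
  have hΦ0 : Integrable (Φ 0) (μ.prod μ) :=
    hdom.mono' (hΦm 0).aestronglyMeasurable (hbd 0 le_rfl)
  have hlim1 : Tendsto (fun n => ∫ p, Φ (e n) p ∂(μ.prod μ)) atTop
      (𝓝 (∫ p, Φ 0 p ∂(μ.prod μ))) := by
    refine tendsto_integral_of_dominated_convergence _
      (fun n => (hΦm (e n)).aestronglyMeasurable) hdom (fun n => hbd _ (he0 n).le) ?_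
    refine Eventually.of_forall (fun p => ?_)
    simp only [hΦ, indicator]
    split_ifs with h
    · have h4 : p.1 < p.2 := h
      have : Tendsto (fun n => (p.2 - p.1 + e n) ^ (β - 2)) atTop
          (𝓝 ((p.2 - p.1 + 0) ^ (β - 2))) :=
        (tendsto_const_nhds.add het).rpow_const (Or.inl (by linarith))
      exact (this.const_mul _).const_mul _
    · exact tendsto_const_nhds
  have hGle : ∀ s ∈ Ioo a t, |G s| ≤ K * (s - a) ^ γ := by
    intro s hs
    have := hK s (Ioo_subset_Icc_self hs) a ⟨le_rfl, hat.le⟩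
    rwa [hGa, sub_zero, abs_of_pos (sub_pos.2 hs.1)] at this
  have hbeta := integrableOn_beta (a := a) (t := t) h0 h1
  have hlim2 : Tendsto (fun n => ∫ s in Ioo a t,
      G s * (s - a) ^ (-β) * (e n ^ β / (s - a + e n) - (t - s + e n) ^ (β - 1))) atTop
      (𝓝 (∫ s in Ioo a t, G s * (s - a) ^ (-β) * (0 - (t - s) ^ (β - 1)))) := by
    -- This majorant is where `G a = 0` enters. The boundary term `e^β / (s - a + e)` is at most `(s
    -- - a)^(β-1)`, and multiplied by `(s - a)^(-β)` it would give the non-integrable `(s -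
    -- a)^(-1)`; the factor `|G s| ≤ K (s - a)^γ` repairs this, and the term then vanishes in the
    -- limit.
    have hd2 : Integrable (fun s => K * (s - a) ^ (γ - 1) +
        (K * (t - a) ^ γ) * ((s - a) ^ (-β) * (t - s) ^ (β - 1))) μ :=
      ((integrableOn_sub_rpow (by linarith)).const_mul K).add (hbeta.const_mul _)
    refine tendsto_integral_of_dominated_convergence _ (fun n => ?_) hd2 (fun n => ?_) ?_
    · exact Measurable.aestronglyMeasurable (by fun_prop)
    · refine ae_restrict_of_forall_mem measurableSet_Ioo (fun s hs => ?_)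
      have h2 : 0 < s - a := by linarith [hs.1]
      have h3 : 0 < t - s := by linarith [hs.2]
      have h4 := he0 n
      have h5 : e n ^ β / (s - a + e n) ≤ (s - a) ^ (β - 1) := by
        rw [div_le_iff₀ (by positivity)]
        calc e n ^ β ≤ (s - a + e n) ^ β := by gcongr; linarith
          _ = (s - a + e n) ^ (β - 1) * (s - a + e n) := by
            rw [← Real.rpow_add_one (by positivity)]; ring_nf
          _ ≤ (s - a) ^ (β - 1) * (s - a + e n) := by
            gcongr 1
            exact Real.rpow_le_rpow_of_nonpos h2 (by linarith) (by linarith)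
      have h6 : (t - s + e n) ^ (β - 1) ≤ (t - s) ^ (β - 1) :=
        Real.rpow_le_rpow_of_nonpos h3 (by linarith) (by linarith)
      have h7 : ‖e n ^ β / (s - a + e n) - (t - s + e n) ^ (β - 1)‖ ≤
          (s - a) ^ (β - 1) + (t - s) ^ (β - 1) := by
        refine (norm_sub_le _ _).trans ?_
        rw [Real.norm_of_nonneg (by positivity), Real.norm_of_nonneg (by positivity)]
        linarith
      rw [norm_mul, norm_mul, Real.norm_of_nonneg (Real.rpow_nonneg h2.le (-β))]
      calc ‖G s‖ * (s - a) ^ (-β) * ‖e n ^ β / (s - a + e n) - (t - s + e n) ^ (β - 1)‖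
          ≤ ‖G s‖ * (s - a) ^ (-β) * ((s - a) ^ (β - 1) + (t - s) ^ (β - 1)) := by gcongr
        _ = ‖G s‖ * ((s - a) ^ (-β) * (s - a) ^ (β - 1)) +
            ‖G s‖ * ((s - a) ^ (-β) * (t - s) ^ (β - 1)) := by ring
        _ ≤ (K * (s - a) ^ γ) * ((s - a) ^ (-β) * (s - a) ^ (β - 1)) +
            (K * (t - a) ^ γ) * ((s - a) ^ (-β) * (t - s) ^ (β - 1)) := by
            gcongr
            · exact hGle s hs
            · refine (hGle s hs).trans ?_
              gcongr
              exact hs.2.le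
        _ = _ := by
            rw [← Real.rpow_add h2, mul_assoc K, ← Real.rpow_add h2]
            congr 3; ring
    · refine ae_restrict_of_forall_mem measurableSet_Ioo (fun s hs => ?_)
      have h2 : 0 < s - a := by linarith [hs.1]
      have h3 : 0 < t - s := by linarith [hs.2]
      refine Tendsto.const_mul _ (Tendsto.sub ?_ ?_)
      · have hn : Tendsto (fun n => e n ^ β) atTop (𝓝 0) := by
          have := het.rpow_const (p := β) (Or.inr h0.le)
          rwa [Real.zero_rpow h0.ne'] at this
        have hdn : Tendsto (fun n => s - a + e n) atTop (𝓝 (s - a)) := by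
          simpa using (tendsto_const_nhds (x := s - a)).add het
        have := hn.div hdn h2.ne'
        rw [zero_div] at this
        exact this
      · have : Tendsto (fun n => (t - s + e n)) atTop (𝓝 (t - s)) := by
          simpa using (tendsto_const_nhds (x := t - s)).add het
        exact this.rpow_const (Or.inl h3.ne')
  have hident := tendsto_nhds_unique (hlim1.const_mul (1 - β))
    (hlim2.congr (fun n => (integral_regularised hG h1 (he0 n)).symm))
  have hin : ∀ s ∈ Ioo a t, ∫ u, Φ 0 (s, u) ∂μ =
      (s - a) ^ (-β) * ∫ u in Ioo s t, (G s - G u) / (u - s) ^ ((1 - β) + 1) := by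
    intro s hs
    simp only [hΦ]
    rw [upperHalf_indicator_left, setIntegral_Ioo_indicator_Ioi hs.1.le, ← integral_const_mul]
    refine setIntegral_congr_fun measurableSet_Ioo (fun u hu => ?_)
    have h2 : 0 < u - s := by linarith [hu.1]
    simp only [add_zero]
    rw [div_eq_mul_inv, ← Real.rpow_neg h2.le]
    congr 3; ring
  have hΦi : Integrable (fun s => ∫ u, Φ 0 (s, u) ∂μ) μ := hΦ0.integral_prod_left
  have hGi : Integrable (fun s => G s * (s - a) ^ (-β) * (0 - (t - s) ^ (β - 1))) μ := by
    have hd2 : Integrable (fun s => 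
        (K * (t - a) ^ γ) * ((s - a) ^ (-β) * (t - s) ^ (β - 1))) μ := hbeta.const_mul _
    refine hd2.mono' (Measurable.aestronglyMeasurable (by fun_prop)) ?_
    refine ae_restrict_of_forall_mem measurableSet_Ioo (fun s hs => ?_)
    have h2 : 0 < s - a := by linarith [hs.1]
    have h3 : 0 < t - s := by linarith [hs.2]
    rw [zero_sub, norm_mul, norm_mul, norm_neg, Real.norm_of_nonneg (Real.rpow_nonneg h2.le (-β)),
      Real.norm_of_nonneg (Real.rpow_nonneg h3.le _), mul_assoc]
    gcongr
    refine (hGle s hs).trans ?_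
    gcongr
    exact hs.2.le
  rw [integral_prod _ hΦ0] at hident
  have : ∀ s ∈ Ioo a t, (s - a) ^ (-β) * (G s / (t - s) ^ (1 - β) +
      (1 - β) * ∫ u in Ioo s t, (G s - G u) / (u - s) ^ ((1 - β) + 1)) =
      (1 - β) * (∫ u, Φ 0 (s, u) ∂μ) - G s * (s - a) ^ (-β) * (0 - (t - s) ^ (β - 1)) := by
    intro s hs
    rw [hin s hs, div_eq_mul_inv, ← Real.rpow_neg (by linarith [hs.2])]
    have : -(1 - β) = β - 1 := by ring
    rw [this]; ring
  rw [setIntegral_congr_fun measurableSet_Ioo this,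
    integral_sub (hΦi.const_mul _) hGi, integral_const_mul, hident, sub_self]

end Inversion

/-! ### The generalized Lebesgue-Stieltjes integral of one indicator. -/

section IndicatorIntegral

/-- The domain of integration moves with `s`. Encoding it by the indicator of a half plane gives a
parametric integral over a fixed domain. -/
lemma measurable_weylRight {β t : ℝ} {G : ℝ → ℝ} (hG : Measurable G) :
    Measurable (weylRight β t G) := by
  have h : ∀ s, ∫ u in Ioo s t, (G s - G u) / (u - s) ^ (β + 1) =
      ∫ u in Iio t, upperHalf.indicator
        (fun p : ℝ × ℝ => (G p.1 - G p.2) / (p.2 - p.1) ^ (β + 1)) (s, u) := by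
    intro s
    rw [upperHalf_indicator_left, setIntegral_indicator measurableSet_Ioi]
    congr 2
    ext u; simp [and_comm]
  have hm : Measurable (fun s => ∫ u in Ioo s t, (G s - G u) / (u - s) ^ (β + 1)) := by
    simp_rw [h]
    have : Measurable (upperHalf.indicator
        (fun p : ℝ × ℝ => (G p.1 - G p.2) / (p.2 - p.1) ^ (β + 1))) :=
      Measurable.indicator (by fun_prop) measurableSet_upperHalf
    exact this.stronglyMeasurable.integral_prod_right'.measurable
  unfold weylRight
  fun_prop

lemma measurable_weylLeft {β : ℝ} {f : ℝ → ℝ} (hf : Measurable f) :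
    Measurable (weylLeft β f) := by
  have h : ∀ s, ∫ u in Ioo 0 s, (f s - f u) / (s - u) ^ (β + 1) =
      ∫ u in Ioi 0, upperHalf.indicator
        (fun p : ℝ × ℝ => (f p.2 - f p.1) / (p.2 - p.1) ^ (β + 1)) (u, s) := by
    intro s
    rw [upperHalf_indicator_right, setIntegral_indicator measurableSet_Iio]
    rfl
  have hm : Measurable (fun s => ∫ u in Ioo 0 s, (f s - f u) / (s - u) ^ (β + 1)) := by
    simp_rw [h]
    have : Measurable (upperHalf.indicator
        (fun p : ℝ × ℝ => (f p.2 - f p.1) / (p.2 - p.1) ^ (β + 1))) :=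
      Measurable.indicator (by fun_prop) measurableSet_upperHalf
    exact this.stronglyMeasurable.integral_prod_left'.measurable
  unfold weylLeft
  fun_prop

/-- The right-sided Weyl derivative of order `1 - β` of a Hölder function of order `γ > 1 - β`
vanishing at `t` is bounded. -/
lemma exists_bound_weylRight {c t β γ K : ℝ} {G : ℝ → ℝ} (h1 : β < 1) (hγ : 1 - β < γ)
    (hK : ∀ s ∈ Icc c t, ∀ r ∈ Icc c t, |G s - G r| ≤ K * |s - r| ^ γ) (hGt : G t = 0) :
    ∃ M, 0 ≤ M ∧ ∀ s ∈ Ioo c t, |weylRight (1 - β) t G s| ≤ M := by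
  set δ := γ + β - 1 with hδ
  have hδ0 : 0 < δ := by simp only [hδ]; linarith
  -- The maximum with 0 keeps the bound nonnegative even if `Ioo c t` is empty.
  refine ⟨|1 / Real.Gamma (1 - (1 - β))| * (|K| * (t - c) ^ δ +
    (1 - β) * (|K| * ((t - c) ^ δ / δ))) ⊔ 0, le_max_right _ _, fun s hs => le_max_of_le_left ?_⟩
  have h3 : 0 < t - s := by linarith [hs.2]
  have h4 : 0 < 1 - β := by linarith
  have hmono : (t - s) ^ δ ≤ (t - c) ^ δ := by gcongr; exact hs.1.le
  have hsm : s ∈ Icc c t := Ioo_subset_Icc_self hs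
  have htm : t ∈ Icc c t := ⟨hs.1.le.trans hs.2.le, le_rfl⟩
  unfold weylRight
  rw [abs_mul]
  gcongr
  refine (abs_add_le _ _).trans (add_le_add ?_ ?_)
  · have := hK s hsm t htm
    rw [hGt, sub_zero, abs_sub_comm, abs_of_pos h3] at this
    rw [abs_div, abs_of_pos (by positivity : 0 < (t - s) ^ (1 - β)), div_le_iff₀ (by positivity)]
    calc |G s| ≤ K * (t - s) ^ γ := this
      _ ≤ |K| * (t - s) ^ γ := by gcongr; exact le_abs_self K
      _ = |K| * (t - s) ^ δ * (t - s) ^ (1 - β) := by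
        rw [mul_assoc, ← Real.rpow_add h3]; congr 2; simp only [hδ]; ring
      _ ≤ _ := by gcongr
  · rw [abs_mul, abs_of_pos h4]
    gcongr
    have hi : IntegrableOn (fun u => |K| * (u - s) ^ (δ - 1)) (Ioo s t) :=
      Integrable.const_mul (integrableOn_sub_rpow (a := s) (b := t)
        (by linarith : -1 < δ - 1)) |K|
    calc |∫ u in Ioo s t, (G s - G u) / (u - s) ^ (1 - β + 1)|
        ≤ ∫ u in Ioo s t, |K| * (u - s) ^ (δ - 1) := by
          rw [← Real.norm_eq_abs]
          refine norm_integral_le_of_norm_le hi ?_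
          refine ae_restrict_of_forall_mem measurableSet_Ioo (fun u hu => ?_)
          have h2 : 0 < u - s := by linarith [hu.1]
          have := hK s hsm u ⟨hs.1.le.trans hu.1.le, hu.2.le⟩
          rw [abs_sub_comm s, abs_of_pos h2] at this
          rw [norm_div, Real.norm_of_nonneg (by positivity : 0 ≤ (u - s) ^ (1 - β + 1)),
            div_le_iff₀ (by positivity), mul_assoc, ← Real.rpow_add h2]
          have e : δ - 1 + (1 - β + 1) = γ := by simp only [hδ]; ring
          rw [e]
          exact this.trans (by gcongr; exact le_abs_self K)
      _ = |K| * ((t - s) ^ δ / δ) := by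
          rw [integral_const_mul, integral_sub_rpow hs.2.le (by linarith), sub_add_cancel]
      _ ≤ _ := by gcongr

/-- The kernel `s ↦ (s - a)_+^{-β}`. -/
noncomputable def plusPow (β a : ℝ) : ℝ → ℝ := (Ioi a).indicator (fun s => (s - a) ^ (-β))

lemma integrableOn_plusPow_mul {a c t β M : ℝ} {W : ℝ → ℝ} (h1 : β < 1) (hca : c ≤ a)
    (hW : Measurable W) (hWM : ∀ s ∈ Ioo c t, |W s| ≤ M) :
    IntegrableOn (fun s => (s - a) ^ (-β) * W s) (Ioo a t) := by
  refine Integrable.mono' ((integrableOn_sub_rpow (a := a) (b := t)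
    (by linarith : -1 < -β)).mul_const M) (by fun_prop) ?_
  refine ae_restrict_of_forall_mem measurableSet_Ioo (fun s hs => ?_)
  have h2 : 0 < s - a := by linarith [hs.1]
  rw [norm_mul, Real.norm_of_nonneg (by positivity)]
  gcongr
  exact hWM s ⟨hca.trans_lt hs.1, hs.2⟩

/-- Inversion of the right-sided Weyl derivative. -/
lemma integral_rpow_mul_weylRight {a c t β γ K : ℝ} {G : ℝ → ℝ} (hG : Continuous G)
    (h0 : 0 < β) (h1 : β < 1) (hγ : 1 - β < γ) (hca : c ≤ a) (hat : a < t)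
    (hK : ∀ s ∈ Icc c t, ∀ r ∈ Icc c t, |G s - G r| ≤ K * |s - r| ^ γ) (hGt : G t = 0) :
    ∫ s in Ioo a t, (s - a) ^ (-β) * weylRight (1 - β) t G s = Real.Gamma (1 - β) * G a := by
  have hzero := integral_weyl_eq_zero (G := fun s => G s - G a) (a := a) (t := t) (K := K)
    (by fun_prop) h0 h1 hγ hat (fun s hs r hr => by
      rw [sub_sub_sub_cancel_right]
      exact hK s ⟨hca.trans hs.1, hs.2⟩ r ⟨hca.trans hr.1, hr.2⟩) (sub_self _)
  obtain ⟨M, -, hM⟩ := exists_bound_weylRight h1 hγ hK hGt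
  have hi := integrableOn_plusPow_mul h1 hca (measurable_weylRight hG.measurable) hM
  have hΓ : Real.Gamma β ≠ 0 := (Real.Gamma_pos_of_pos h0).ne'
  have hb := integrableOn_beta (a := a) (t := t) h0 h1
  -- Replacing `G` by `G - G a` leaves the inner differences unchanged and only alters the boundary
  -- term, whose contribution is `G a` times a Beta integral.
  have heq : ∀ s ∈ Ioo a t, (s - a) ^ (-β) * ((G s - G a) / (t - s) ^ (1 - β) +
      (1 - β) * ∫ u in Ioo s t, ((G s - G a) - (G u - G a)) / (u - s) ^ ((1 - β) + 1)) =
      Real.Gamma β * ((s - a) ^ (-β) * weylRight (1 - β) t G s) -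
        G a * ((s - a) ^ (-β) * (t - s) ^ (β - 1)) := by
    intro s hs
    simp only [sub_sub_sub_cancel_right, weylRight, sub_sub_cancel]
    have e : β - 1 = -(1 - β) := by ring
    rw [e, Real.rpow_neg (show 0 ≤ t - s by linarith [hs.2])]
    field_simp
    ring
  rw [setIntegral_congr_fun measurableSet_Ioo heq, integral_sub (hi.const_mul _) (hb.const_mul _),
    integral_const_mul, integral_const_mul, integral_beta h0 h1 hat] at hzero
  have : Real.Gamma β * ((∫ s in Ioo a t, (s - a) ^ (-β) * weylRight (1 - β) t G s) -
      Real.Gamma (1 - β) * G a) = 0 := by linarith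
  rcases mul_eq_zero.1 this with h | h
  · exact absurd h hΓ
  · linarith

/-- The left-sided Weyl derivative of the indicator of `(a,b]`. -/
lemma weylLeft_indicator {a b s β : ℝ} (h0 : 0 < β) (ha : 0 ≤ a) (hab : a ≤ b) :
    weylLeft β ((Ioc a b).indicator 1) s =
      1 / Real.Gamma (1 - β) * (plusPow β a s - plusPow β b s) := by
  unfold weylLeft plusPow
  congr 1
  rcases le_or_gt s a with h | h
  · have h1 : ∀ u ∈ Ioo 0 s, ((Ioc a b).indicator (1 : ℝ → ℝ) s -
        (Ioc a b).indicator (1 : ℝ → ℝ) u) / (s - u) ^ (β + 1) = 0 := by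
      intro u hu
      rw [indicator_of_notMem (by simp [h]),
        indicator_of_notMem (by simp [(hu.2.le.trans h)])]
      simp
    rw [setIntegral_congr_fun measurableSet_Ioo h1, indicator_of_notMem (by simp [h]),
      indicator_of_notMem (by simpa using h), indicator_of_notMem (by simpa using h.trans hab)]
    simp
  have hs : 0 < s := by linarith
  rcases le_or_gt s b with hb | hb
  · have h1 : ∀ u ∈ Ioo 0 s, ((Ioc a b).indicator (1 : ℝ → ℝ) s -
        (Ioc a b).indicator (1 : ℝ → ℝ) u) / (s - u) ^ (β + 1) =
        (Ioc 0 a).indicator (fun u => (s - u) ^ (-(β + 1))) u := by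
      intro u hu
      have h2 : 0 < s - u := by linarith [hu.2]
      rw [indicator_of_mem (show s ∈ Ioc a b from ⟨h, hb⟩)]
      rcases le_or_gt u a with hu' | hu'
      · rw [indicator_of_notMem (by simp [hu']),
          indicator_of_mem (show u ∈ Ioc 0 a from ⟨hu.1, hu'⟩), Real.rpow_neg h2.le]
        simp
      · rw [indicator_of_mem (show u ∈ Ioc a b from ⟨hu', hu.2.le.trans hb⟩),
          indicator_of_notMem (by simp [hu'])]
        simp
    have h3 : Ioo 0 s ∩ Ioc 0 a = Ioc 0 a := by
      ext u; simp only [mem_inter_iff, mem_Ioo, mem_Ioc]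
      constructor
      · exact fun h => h.2
      · exact fun h' => ⟨⟨h'.1, by linarith [h'.2]⟩, h'⟩
    rw [setIntegral_congr_fun measurableSet_Ioo h1, setIntegral_indicator measurableSet_Ioc, h3,
      integral_Ioc_rsub_rpow_of_lt h0 ha h, indicator_of_mem (show s ∈ Ioc a b from ⟨h, hb⟩),
      indicator_of_mem (show s ∈ Ioi a from h), indicator_of_notMem (by simpa using hb)]
    -- The boundary term `s^(-β)` cancels against the lower limit 0 of the integral over `(0, a]`,
    -- leaving `(s - a)^(-β)` alone.
    rw [sub_zero, Real.rpow_neg hs.le]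
    simp only [Pi.one_apply]
    field_simp
    ring
  · have h1 : ∀ u ∈ Ioo 0 s, ((Ioc a b).indicator (1 : ℝ → ℝ) s -
        (Ioc a b).indicator (1 : ℝ → ℝ) u) / (s - u) ^ (β + 1) =
        (Ioc a b).indicator (fun u => -(s - u) ^ (-(β + 1))) u := by
      intro u hu
      have h2 : 0 < s - u := by linarith [hu.2]
      rw [indicator_of_notMem (show s ∉ Ioc a b by simp [hb])]
      by_cases hu' : u ∈ Ioc a b
      · rw [indicator_of_mem hu', indicator_of_mem hu', Real.rpow_neg h2.le]
        simp [div_eq_mul_inv]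
      · rw [indicator_of_notMem hu', indicator_of_notMem hu']
        simp
    have h3 : Ioo 0 s ∩ Ioc a b = Ioc a b := by
      ext u; simp only [mem_inter_iff, mem_Ioo, mem_Ioc]
      constructor
      · exact fun h => h.2
      · exact fun h' => ⟨⟨by linarith [h'.1], by linarith [h'.2]⟩, h'⟩
    rw [setIntegral_congr_fun measurableSet_Ioo h1, setIntegral_indicator measurableSet_Ioc, h3,
      integral_neg, integral_Ioc_rsub_rpow_of_lt h0 hab hb,
      indicator_of_notMem (show s ∉ Ioc a b by simp [hb]),
      indicator_of_mem (show s ∈ Ioi a from h), indicator_of_mem (show s ∈ Ioi b from hb)]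
    field_simp
    ring

/-- The generalized Lebesgue-Stieltjes integral of the indicator of `(a,b]`. -/
lemma integral_weyl_indicator {a b c t β γ K : ℝ} {G : ℝ → ℝ} (hG : Continuous G)
    (h0 : 0 < β) (h1 : β < 1) (hγ : 1 - β < γ) (hc : 0 ≤ c) (hca : c ≤ a) (hab : a ≤ b)
    (hbt : b ≤ t)
    (hK : ∀ s ∈ Icc c t, ∀ r ∈ Icc c t, |G s - G r| ≤ K * |s - r| ^ γ) (hGt : G t = 0) :
    ∫ s in Ioo 0 t, weylLeft β ((Ioc a b).indicator 1) s * weylRight (1 - β) t G s =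
      G a - G b := by
  obtain ⟨M, -, hM⟩ := exists_bound_weylRight h1 hγ hK hGt
  have hW := measurable_weylRight (β := 1 - β) (t := t) hG.measurable
  have hΓ : Real.Gamma (1 - β) ≠ 0 := (Real.Gamma_pos_of_pos (by linarith)).ne'
  have hset : ∀ a, c ≤ a → Ioo 0 t ∩ Ioi a = Ioo a t := by
    intro a ha
    ext s; simp only [mem_inter_iff, mem_Ioo, mem_Ioi]
    constructor
    · exact fun h => ⟨h.2, h.1.2⟩
    · exact fun h => ⟨⟨by linarith [h.1], h.2⟩, h.1⟩
  have hmul : ∀ a, (fun s => plusPow β a s * weylRight (1 - β) t G s) =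
      (Ioi a).indicator (fun s => (s - a) ^ (-β) * weylRight (1 - β) t G s) := by
    intro a; ext s; unfold plusPow
    by_cases hs : s ∈ Ioi a
    · rw [indicator_of_mem hs, indicator_of_mem hs]
    · rw [indicator_of_notMem hs, indicator_of_notMem hs, zero_mul]
  have hint : ∀ a, c ≤ a →
      IntegrableOn (fun s => plusPow β a s * weylRight (1 - β) t G s) (Ioo 0 t) := by
    intro a ha
    rw [hmul, IntegrableOn, integrable_indicator_iff measurableSet_Ioi, IntegrableOn,
      Measure.restrict_restrict measurableSet_Ioi, inter_comm, hset a ha]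
    exact integrableOn_plusPow_mul h1 ha hW hM
  have hval : ∀ a, c ≤ a → a ≤ t →
      ∫ s in Ioo 0 t, plusPow β a s * weylRight (1 - β) t G s = Real.Gamma (1 - β) * G a := by
    intro a ha hat
    rw [hmul, setIntegral_indicator measurableSet_Ioi, hset a ha]
    rcases hat.lt_or_eq with h | h
    · exact integral_rpow_mul_weylRight hG h0 h1 hγ ha h hK hGt
    · rw [h, hGt]; simp
  have : ∀ s, weylLeft β ((Ioc a b).indicator 1) s * weylRight (1 - β) t G s =
      1 / Real.Gamma (1 - β) * (plusPow β a s * weylRight (1 - β) t G s -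
        plusPow β b s * weylRight (1 - β) t G s) := by
    intro s
    rw [weylLeft_indicator h0 (hc.trans hca) hab]; ring
  simp_rw [this]
  rw [integral_const_mul, integral_sub (hint a hca) (hint b (hca.trans hab)),
    hval a hca (hab.trans hbt), hval b (hca.trans hab) hbt]
  field_simp

end IndicatorIntegral

/-! ### Fractional Besov norm of an indicator, and its control of the left Weyl derivative. -/

section StepIntegral

lemma setLIntegral_ofReal_eq {f : ℝ → ℝ} {s : Set ℝ} (hs : MeasurableSet s)
    (hf : IntegrableOn f s) (h0 : ∀ x ∈ s, 0 ≤ f x) :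
    ∫⁻ x in s, ENNReal.ofReal (f x) = ENNReal.ofReal (∫ x in s, f x) :=
  (ofReal_integral_eq_lintegral_ofReal hf (ae_restrict_of_forall_mem hs h0)).symm

/-- The inner integral of the fractional Besov norm. -/
noncomputable def besovInner (β : ℝ) (f : ℝ → ℝ) (s : ℝ) : ℝ≥0∞ :=
  ∫⁻ u in Ioo 0 s, ENNReal.ofReal (|f s - f u| / (s - u) ^ (1 + β))

lemma measurable_besovInner {β : ℝ} {f : ℝ → ℝ} (hf : Measurable f) :
    Measurable (besovInner β f) := by
  have h : ∀ s, besovInner β f s =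
      ∫⁻ u in Ioi 0, upperHalf.indicator
        (fun p : ℝ × ℝ => ENNReal.ofReal (|f p.2 - f p.1| / (p.2 - p.1) ^ (1 + β))) (u, s) := by
    intro s
    have : (fun u => upperHalf.indicator
        (fun p : ℝ × ℝ => ENNReal.ofReal (|f p.2 - f p.1| / (p.2 - p.1) ^ (1 + β))) (u, s)) =
        (Iio s).indicator (fun u => ENNReal.ofReal (|f s - f u| / (s - u) ^ (1 + β))) := rfl
    rw [this, setLIntegral_indicator measurableSet_Iio, inter_comm]
    rfl
  have : Measurable (upperHalf.indicator
      (fun p : ℝ × ℝ => ENNReal.ofReal (|f p.2 - f p.1| / (p.2 - p.1) ^ (1 + β)))) :=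
    Measurable.indicator (by fun_prop) measurableSet_upperHalf
  have h2 : besovInner β f = fun s => ∫⁻ u in Ioi 0, upperHalf.indicator
        (fun p : ℝ × ℝ => ENNReal.ofReal (|f p.2 - f p.1| / (p.2 - p.1) ^ (1 + β))) (u, s) :=
    funext h
  rw [h2]
  exact this.lintegral_prod_left'

lemma besovNorm_eq (β t : ℝ) (f : ℝ → ℝ) :
    besovNorm β t f = (∫⁻ s in Ioo 0 t, ENNReal.ofReal (|f s| / s ^ β)) +
      ∫⁻ s in Ioo 0 t, besovInner β f s := rfl

/-- Only points `u` on the other side of a jump contribute: `u ≤ a` when `s` lies in `(a, b]`, and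
`u` in `(a, b]` when `s > b`. The kernel integrates explicitly, and in the first case the
nonnegative `s^(-β)` is dropped. -/
lemma besovInner_indicator_le {a b s β : ℝ} (h0 : 0 < β) (ha : 0 ≤ a) (hab : a ≤ b) :
    besovInner β ((Ioc a b).indicator 1) s ≤
      (Ioc a b).indicator (fun s => ENNReal.ofReal ((s - a) ^ (-β) / β)) s +
      (Ioi b).indicator (fun s => ENNReal.ofReal (((s - b) ^ (-β) - (s - a) ^ (-β)) / β)) s := by
  have hpow : ∀ u < s, 1 / (s - u) ^ (1 + β) = (s - u) ^ (-(β + 1)) := by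
    intro u hu
    rw [Real.rpow_neg (by linarith), add_comm, one_div]
  rcases le_or_gt s a with h | h
  · have : besovInner β ((Ioc a b).indicator 1) s = 0 := by
      refine (setLIntegral_congr_fun measurableSet_Ioo (g := fun _ => 0) (fun u hu => ?_)).trans
        (by simp)
      simp only
      rw [indicator_of_notMem (show s ∉ Ioc a b by simp [h]),
        indicator_of_notMem (show u ∉ Ioc a b by simp [(hu.2.le.trans h)])]
      simp
    rw [this]; exact zero_le
  rcases le_or_gt s b with hb | hb
  · rw [indicator_of_mem (show s ∈ Ioc a b from ⟨h, hb⟩),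
      indicator_of_notMem (show s ∉ Ioi b by simpa using hb), add_zero]
    calc besovInner β ((Ioc a b).indicator 1) s
        ≤ ∫⁻ u in Ioo 0 s, (Ioc 0 a).indicator
            (fun u => ENNReal.ofReal ((s - u) ^ (-(β + 1)))) u := by
          refine setLIntegral_mono' measurableSet_Ioo (fun u hu => ?_)
          rw [indicator_of_mem (show s ∈ Ioc a b from ⟨h, hb⟩)]
          rcases le_or_gt u a with hu' | hu'
          · rw [indicator_of_notMem (show u ∉ Ioc a b by simp [hu']),
              indicator_of_mem (show u ∈ Ioc 0 a from ⟨hu.1, hu'⟩), ← hpow u hu.2]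
            simp
          · rw [indicator_of_mem (show u ∈ Ioc a b from ⟨hu', hu.2.le.trans hb⟩)]
            simp
      _ ≤ ∫⁻ u in Ioc 0 a, ENNReal.ofReal ((s - u) ^ (-(β + 1))) := by
          rw [setLIntegral_indicator measurableSet_Ioc]
          exact lintegral_mono_set inter_subset_left
      _ = ENNReal.ofReal (((s - a) ^ (-β) - (s - 0) ^ (-β)) / β) := by
          rw [setLIntegral_ofReal_eq measurableSet_Ioc (integrableOn_Ioc_rsub_rpow_of_lt h)
            (fun u hu => Real.rpow_nonneg (by linarith [hu.2]) _),
            integral_Ioc_rsub_rpow_of_lt h0 ha h]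
      _ ≤ _ := by
          gcongr
          have : 0 ≤ (s - 0) ^ (-β) := Real.rpow_nonneg (by linarith) _
          linarith
  · rw [indicator_of_notMem (show s ∉ Ioc a b by simp [hb]),
      indicator_of_mem (show s ∈ Ioi b from hb), zero_add]
    calc besovInner β ((Ioc a b).indicator 1) s
        ≤ ∫⁻ u in Ioo 0 s, (Ioc a b).indicator
            (fun u => ENNReal.ofReal ((s - u) ^ (-(β + 1)))) u := by
          refine setLIntegral_mono' measurableSet_Ioo (fun u hu => ?_)
          rw [indicator_of_notMem (show s ∉ Ioc a b by simp [hb])]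
          by_cases hu' : u ∈ Ioc a b
          · rw [indicator_of_mem hu', indicator_of_mem hu', ← hpow u hu.2]
            simp
          · rw [indicator_of_notMem hu', indicator_of_notMem hu']
            simp
      _ ≤ ∫⁻ u in Ioc a b, ENNReal.ofReal ((s - u) ^ (-(β + 1))) := by
          rw [setLIntegral_indicator measurableSet_Ioc]
          exact lintegral_mono_set inter_subset_left
      _ = _ := by
          rw [setLIntegral_ofReal_eq measurableSet_Ioc (integrableOn_Ioc_rsub_rpow_of_lt hb)
            (fun u hu => Real.rpow_nonneg (by linarith [hu.2]) _),
            integral_Ioc_rsub_rpow_of_lt h0 hab hb]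

/-- Indicators of short intervals have small fractional Besov norm. -/
lemma besovNorm_indicator_le {a b t β : ℝ} (h0 : 0 < β) (h1 : β < 1) (ha : 0 ≤ a) (hab : a ≤ b)
    (hbt : b ≤ t) :
    besovNorm β t ((Ioc a b).indicator 1) ≤
      ENNReal.ofReal ((1 + 2 / β) / (1 - β) * (b - a) ^ (1 - β)) := by
  have h1' : 0 < 1 - β := by linarith
  have hba : 0 ≤ b - a := by linarith
  set J := (b - a) ^ (1 - β) / (1 - β) with hJ
  have hJ0 : 0 ≤ J := by positivity
  have hexp : -β + 1 = 1 - β := by ring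
  have hIoo : ∀ k : ℝ, 0 ≤ k → ∫⁻ s in Ioc a b, ENNReal.ofReal ((s - a) ^ (-β) * k) =
      ENNReal.ofReal (J * k) := by
    intro k hk
    rw [setLIntegral_congr Ioo_ae_eq_Ioc.symm, setLIntegral_ofReal_eq measurableSet_Ioo
      ((integrableOn_sub_rpow (by linarith)).mul_const k)
      (fun s hs => mul_nonneg (Real.rpow_nonneg (by linarith [hs.1]) _) hk),
      integral_mul_const, integral_sub_rpow hab (by linarith), hexp]
  have hA : ∫⁻ s in Ioo 0 t, ENNReal.ofReal (|(Ioc a b).indicator (1 : ℝ → ℝ) s| / s ^ β) ≤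
      ENNReal.ofReal J := by
    calc _ ≤ ∫⁻ s in Ioo 0 t, (Ioc a b).indicator
          (fun s => ENNReal.ofReal ((s - a) ^ (-β) * 1)) s := by
          refine setLIntegral_mono' measurableSet_Ioo (fun s hs => ?_)
          by_cases h : s ∈ Ioc a b
          · rw [indicator_of_mem h, indicator_of_mem h, mul_one, Pi.one_apply, abs_one, one_div,
              ← Real.rpow_neg hs.1.le]
            have : 0 < s - a := by linarith [h.1]
            exact ENNReal.ofReal_le_ofReal
              (Real.rpow_le_rpow_of_nonpos this (by linarith) (by linarith))
          · rw [indicator_of_notMem h, indicator_of_notMem h]; simp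
      _ ≤ ∫⁻ s in Ioc a b, ENNReal.ofReal ((s - a) ^ (-β) * 1) := by
          rw [setLIntegral_indicator measurableSet_Ioc]
          exact lintegral_mono_set inter_subset_left
      _ = _ := by rw [hIoo 1 zero_le_one, mul_one]
  have hB : ∫⁻ s in Ioo 0 t, (Ioc a b).indicator
      (fun s => ENNReal.ofReal ((s - a) ^ (-β) / β)) s ≤ ENNReal.ofReal (J * β⁻¹) := by
    rw [setLIntegral_indicator measurableSet_Ioc, ← hIoo _ (by positivity)]
    exact lintegral_mono_set inter_subset_left
  -- The difference of the two kernels must be kept: its integral over `(b, t)` is at most `(b -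
  -- a)^(1-β) / (1 - β)`, uniformly in `t`, whereas each kernel alone gives no smallness for a short
  -- `(a, b]`.
  have hC : ∫⁻ s in Ioo 0 t, (Ioi b).indicator
      (fun s => ENNReal.ofReal (((s - b) ^ (-β) - (s - a) ^ (-β)) / β)) s ≤
      ENNReal.ofReal (J * β⁻¹) := by
    have hi1 : IntegrableOn (fun s => (s - b) ^ (-β)) (Ioo b t) :=
      integrableOn_sub_rpow (by linarith)
    have hi2 : IntegrableOn (fun s => (s - a) ^ (-β)) (Ioo b t) :=
      (integrableOn_sub_rpow (a := a) (b := t) (by linarith)).mono_set (Ioo_subset_Ioo_left hab)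
    have hv : ∫ s in Ioo b t, (s - a) ^ (-β) =
        ((t - a) ^ (1 - β) - (b - a) ^ (1 - β)) / (1 - β) := by
      rw [← integral_Ioc_eq_integral_Ioo, ← intervalIntegral.integral_of_le hbt,
        intervalIntegral.integral_comp_sub_right (fun x => x ^ (-β)),
        integral_rpow (Or.inl (by linarith)), hexp]
    calc _ ≤ ∫⁻ s in Ioo b t, ENNReal.ofReal (((s - b) ^ (-β) - (s - a) ^ (-β)) / β) := by
          rw [setLIntegral_indicator measurableSet_Ioi]
          exact lintegral_mono_set (fun s hs => ⟨hs.1, hs.2.2⟩)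
      _ = ENNReal.ofReal (∫ s in Ioo b t, ((s - b) ^ (-β) - (s - a) ^ (-β)) / β) := by
          refine setLIntegral_ofReal_eq measurableSet_Ioo ((hi1.sub hi2).div_const β)
            (fun s hs => ?_)
          refine div_nonneg (sub_nonneg.2 ?_) h0.le
          exact Real.rpow_le_rpow_of_nonpos (by linarith [hs.1]) (by linarith) (by linarith)
      _ ≤ _ := by
          refine ENNReal.ofReal_le_ofReal ?_
          rw [integral_div, integral_sub hi1 hi2, hv, integral_sub_rpow hbt (by linarith), hexp,
            ← div_eq_mul_inv]
          refine div_le_div_of_nonneg_right ?_ h0.le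
          rw [hJ, ← sub_div]
          refine div_le_div_of_nonneg_right ?_ h1'.le
          have : (t - b) ^ (1 - β) ≤ (t - a) ^ (1 - β) :=
            Real.rpow_le_rpow (by linarith) (by linarith) h1'.le
          linarith
  have hD : ∫⁻ s in Ioo 0 t, besovInner β ((Ioc a b).indicator 1) s ≤
      ENNReal.ofReal (J * β⁻¹) + ENNReal.ofReal (J * β⁻¹) := by
    refine (lintegral_mono (fun s => besovInner_indicator_le h0 ha hab)).trans ?_
    rw [lintegral_add_left]
    · exact add_le_add hB hC
    · exact Measurable.indicator (by fun_prop) measurableSet_Ioc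
  rw [besovNorm_eq]
  refine (add_le_add hA hD).trans (le_of_eq ?_)
  rw [← ENNReal.ofReal_add (by positivity) (by positivity),
    ← ENNReal.ofReal_add (by positivity) (by positivity)]
  congr 1
  rw [hJ]; field_simp; ring

lemma enorm_weylLeft_le {β s : ℝ} (f : ℝ → ℝ) (h0 : 0 < β) (h1 : β < 1) (hs : 0 < s) :
    ‖weylLeft β f s‖ₑ ≤ ENNReal.ofReal (1 / Real.Gamma (1 - β)) *
      (ENNReal.ofReal (|f s| / s ^ β) + besovInner β f s) := by
  have hΓ := Real.Gamma_pos_of_pos (show 0 < 1 - β by linarith)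
  unfold weylLeft
  rw [enorm_mul, Real.enorm_of_nonneg (by positivity)]
  gcongr
  refine (enorm_add_le _ _).trans (add_le_add ?_ ?_)
  · rw [← ofReal_norm, norm_div, Real.norm_eq_abs, Real.norm_of_nonneg (by positivity)]
  · rw [enorm_mul, Real.enorm_of_nonneg h0.le]
    calc ENNReal.ofReal β * ‖∫ u in Ioo 0 s, (f s - f u) / (s - u) ^ (β + 1)‖ₑ
        ≤ 1 * ∫⁻ u in Ioo 0 s, ‖(f s - f u) / (s - u) ^ (β + 1)‖ₑ := by
          gcongr
          · exact ENNReal.ofReal_le_one.2 h1.le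
          · exact enorm_integral_le_lintegral_enorm _
      _ = besovInner β f s := by
          rw [one_mul]
          refine setLIntegral_congr_fun measurableSet_Ioo (fun u hu => ?_)
          have : 0 < s - u := by linarith [hu.2]
          rw [← ofReal_norm, norm_div, Real.norm_eq_abs, Real.norm_of_nonneg (by positivity),
            add_comm]

/-- Against a bounded right Weyl derivative, the Besov norm therefore dominates the integral; this
is what allows series to be integrated term by term. -/
lemma lintegral_enorm_weylLeft_le {β t : ℝ} {f : ℝ → ℝ} (hf : Measurable f) (h0 : 0 < β)
    (h1 : β < 1) : ∫⁻ s in Ioo 0 t, ‖weylLeft β f s‖ₑ ≤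
      ENNReal.ofReal (1 / Real.Gamma (1 - β)) * besovNorm β t f := by
  refine (setLIntegral_mono' measurableSet_Ioo
    (fun s hs => enorm_weylLeft_le f h0 h1 hs.1)).trans (le_of_eq ?_)
  rw [lintegral_const_mul, lintegral_add_left, besovNorm_eq]
  · fun_prop
  · exact Measurable.add (by fun_prop) (measurable_besovInner hf)

end StepIntegral

/-! ### Besov norm and left Weyl derivative of a series. -/

section StepSeries

lemma ofReal_abs_div (x w : ℝ) :
    ENNReal.ofReal (|x| / w) = ‖x‖ₑ * ENNReal.ofReal (w⁻¹) := by
  rw [div_eq_mul_inv, ENNReal.ofReal_mul (abs_nonneg _), ← Real.norm_eq_abs, ofReal_norm]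

/-- Summability is not required: a series of reals that is not summable has `tsum` equal to 0. -/
lemma ofReal_abs_tsum_div_le {ι : Type*} {θ y : ι → ℝ} {w : ℝ} :
    ENNReal.ofReal (|∑' p, θ p * y p| / w) ≤ ∑' p, ‖θ p‖ₑ * ENNReal.ofReal (|y p| / w) := by
  simp_rw [ofReal_abs_div, ← mul_assoc, ENNReal.tsum_mul_right]
  gcongr
  refine enorm_tsum_le_tsum_enorm.trans (le_of_eq ?_)
  simp_rw [enorm_mul]

lemma summable_of_tsum_enorm_ne_top {ι : Type*} {f : ι → ℝ} (h : ∑' p, ‖f p‖ₑ ≠ ∞) : Summable f :=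
  Summable.of_nnnorm (ENNReal.tsum_coe_ne_top_iff_summable.1 h)

variable {ι : Type*} [Countable ι] {θ : ι → ℝ} {φ : ι → ℝ → ℝ}

/-- The fractional Besov norm is countably subadditive. -/
lemma besovInner_tsum_le {β s : ℝ} (hφ : ∀ p, Measurable (φ p))
    (hsum : ∀ s, Summable (fun p => θ p * φ p s)) :
    besovInner β (fun s => ∑' p, θ p * φ p s) s ≤ ∑' p, ‖θ p‖ₑ * besovInner β (φ p) s := by
  unfold besovInner
  have h1 : ∀ p, AEMeasurable (fun u => ‖θ p‖ₑ * ENNReal.ofReal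
      (|φ p s - φ p u| / (s - u) ^ (1 + β))) (volume.restrict (Ioo 0 s)) := by
    intro p
    have := hφ p
    fun_prop
  calc _ ≤ ∫⁻ u in Ioo 0 s, ∑' p, ‖θ p‖ₑ * ENNReal.ofReal
          (|φ p s - φ p u| / (s - u) ^ (1 + β)) := by
        refine setLIntegral_mono' measurableSet_Ioo (fun u hu => ?_)
        have h2 : 0 < s - u := by linarith [hu.2]
        rw [← (hsum s).tsum_sub (hsum u)]
        simp_rw [← mul_sub]
        exact ofReal_abs_tsum_div_le
    _ = _ := by
        rw [lintegral_tsum h1]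
        congr 1; ext p
        rw [lintegral_const_mul']
        simp

lemma besovNorm_tsum_le {β t : ℝ} (hφ : ∀ p, Measurable (φ p))
    (hsum : ∀ s, Summable (fun p => θ p * φ p s)) :
    besovNorm β t (fun s => ∑' p, θ p * φ p s) ≤ ∑' p, ‖θ p‖ₑ * besovNorm β t (φ p) := by
  simp_rw [besovNorm_eq, mul_add]
  rw [ENNReal.tsum_add]
  refine add_le_add ?_ ?_
  · calc _ ≤ ∫⁻ s in Ioo 0 t, ∑' p, ‖θ p‖ₑ * ENNReal.ofReal (|φ p s| / s ^ β) := by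
          refine setLIntegral_mono' measurableSet_Ioo (fun s hs => ?_)
          exact ofReal_abs_tsum_div_le
      _ = _ := by
          rw [lintegral_tsum]
          · congr 1; ext p
            rw [lintegral_const_mul']
            simp
          · intro p
            have := hφ p
            fun_prop
  · calc _ ≤ ∫⁻ s in Ioo 0 t, ∑' p, ‖θ p‖ₑ * besovInner β (φ p) s :=
          lintegral_mono (fun s => besovInner_tsum_le hφ hsum)
      _ = _ := by
          rw [lintegral_tsum]
          · congr 1; ext p
            rw [lintegral_const_mul']
            simp
          · intro p
            exact ((measurable_besovInner (hφ p)).const_mul _).aemeasurable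

/-- The left-sided Weyl derivative of a series, at points where the inner integrals are
absolutely summable. -/
lemma weylLeft_tsum {β s : ℝ} (hφ : ∀ p, Measurable (φ p))
    (hsum : ∀ s, Summable (fun p => θ p * φ p s))
    (hs : ∑' p, ‖θ p‖ₑ * besovInner β (φ p) s ≠ ∞) :
    weylLeft β (fun s => ∑' p, θ p * φ p s) s = ∑' p, θ p * weylLeft β (φ p) s := by
  have hen : ∀ p, ∫⁻ u in Ioo 0 s, ‖θ p * ((φ p s - φ p u) / (s - u) ^ (β + 1))‖ₑ =
      ‖θ p‖ₑ * besovInner β (φ p) s := by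
    intro p
    simp_rw [enorm_mul]
    rw [lintegral_const_mul' _ _ (by simp)]
    congr 1
    refine setLIntegral_congr_fun measurableSet_Ioo (fun u hu => ?_)
    have : 0 < s - u := by linarith [hu.2]
    rw [← ofReal_norm, norm_div, Real.norm_eq_abs, Real.norm_of_nonneg (by positivity), add_comm]
  have hint : ∫ u in Ioo 0 s, ((∑' p, θ p * φ p s) - ∑' p, θ p * φ p u) / (s - u) ^ (β + 1) =
      ∑' p, θ p * ∫ u in Ioo 0 s, (φ p s - φ p u) / (s - u) ^ (β + 1) := by
    have h1 : ∀ u, ((∑' p, θ p * φ p s) - ∑' p, θ p * φ p u) / (s - u) ^ (β + 1) =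
        ∑' p, θ p * ((φ p s - φ p u) / (s - u) ^ (β + 1)) := by
      intro u
      rw [← (hsum s).tsum_sub (hsum u), ← tsum_div_const]
      congr 1; ext p; ring
    simp_rw [h1]
    rw [integral_tsum]
    · simp_rw [integral_const_mul]
    · intro p
      have := hφ p
      exact Measurable.aestronglyMeasurable (by fun_prop)
    · simp_rw [hen]; exact hs
  have hS : Summable (fun p => θ p * ∫ u in Ioo 0 s, (φ p s - φ p u) / (s - u) ^ (β + 1)) := by
    refine summable_of_tsum_enorm_ne_top (ne_top_of_le_ne_top hs (ENNReal.tsum_le_tsum fun p => ?_))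
    rw [← integral_const_mul, ← hen p]
    exact enorm_integral_le_lintegral_enorm _
  unfold weylLeft
  simp only
  rw [hint, ← tsum_div_const, ← tsum_mul_left, ← ((hsum s).div_const _).tsum_add (hS.mul_left _),
    ← tsum_mul_left]
  congr 1; ext p; ring

end StepSeries

/-! ### Integrating countably many steps. -/

section StepGLS

/-- Countable sums of multiples of disjoint indicators are integrable in the generalized
Lebesgue-Stieltjes sense as soon as the fractional Besov norms are summable. -/
theorem hasGLSIntegral_step {ι : Type*} [Countable ι] {β γ c t K : ℝ} (hβ : β ∈ Ioo (0 : ℝ) 1)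
    (hγ : 1 - β < γ) (hc : 0 ≤ c) (hct : c < t) {g : ℝ → ℝ} (hg : ContinuousOn g (Icc 0 t))
    (hK : ∀ s ∈ Icc c t, ∀ r ∈ Icc c t, |g s - g r| ≤ K * |s - r| ^ γ)
    (hconv : ∀ᵐ s ∂(volume.restrict (Ioo 0 t)),
      IntegrableOn (fun u => (g s - g u) / (u - s) ^ ((1 - β) + 1)) (Ioo s t))
    {l r : ι → ℝ} (hl : ∀ p, c ≤ l p) (hlr : ∀ p, l p ≤ r p) (hr : ∀ p, r p ≤ t)
    (hdisj : ∀ s p q, s ∈ Ioc (l p) (r p) → s ∈ Ioc (l q) (r q) → p = q) {θ : ι → ℝ}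
    (hsum : Summable (fun p => |θ p| * (r p - l p) ^ (1 - β))) :
    HasGLSIntegral β (fun s => ∑' p, θ p * (Ioc (l p) (r p)).indicator 1 s) g t
      (∑' p, θ p * (g (r p) - g (l p))) := by
  obtain ⟨h0, h1⟩ := hβ
  have ht : 0 ≤ t := hc.trans hct.le
  set φ : ι → ℝ → ℝ := fun p => (Ioc (l p) (r p)).indicator 1 with hφ
  have hφm : ∀ p, Measurable (φ p) := fun p => measurable_one.indicator measurableSet_Ioc
  have hfin : ∀ s, Summable (fun p => θ p * φ p s) := by
    intro s
    by_cases h : ∃ p, s ∈ Ioc (l p) (r p)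
    · obtain ⟨p, hp⟩ := h
      refine summable_of_ne_finset_zero (s := {p}) (fun q hq => ?_)
      rw [Finset.mem_singleton] at hq
      simp only [hφ]
      rw [indicator_of_notMem (fun h => hq (hdisj s q p h hp)), mul_zero]
    · push Not at h
      refine summable_of_ne_finset_zero (s := ∅) (fun q _ => ?_)
      simp only [hφ]
      rw [indicator_of_notMem (h q), mul_zero]
  set f : ℝ → ℝ := fun s => ∑' p, θ p * φ p s with hf
  have hfm : Measurable f := Measurable.tsum (fun p => (hφm p).const_mul (θ p))
  have hBesov : ∑' p, ‖θ p‖ₑ * besovNorm β t (φ p) ≠ ∞ := by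
    refine ne_top_of_le_ne_top (hsum.mul_right ((1 + 2 / β) / (1 - β))).tsum_ofReal_ne_top
      (ENNReal.tsum_le_tsum fun p => ?_)
    rw [mul_assoc, ENNReal.ofReal_mul (abs_nonneg _), ← Real.norm_eq_abs, ofReal_norm,
      mul_comm ((r p - l p) ^ (1 - β))]
    gcongr
    exact besovNorm_indicator_le h0 h1 (hc.trans (hl p)) (hlr p) (hr p)
  have hfB : besovNorm β t f < ∞ :=
    (besovNorm_tsum_le hφm hfin).trans_lt (lt_top_iff_ne_top.2 hBesov)
  -- The extension constant outside `[0, t]` provides the globally continuous function assumed by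
  -- the inversion lemmas; Weyl derivatives on `(0, t)` do not see the difference.
  set g' : ℝ → ℝ := IccExtend ht ((Icc 0 t).domRestrict g) with hg'
  have hg'c : Continuous g' := (hg.domRestrict).Icc_extend'
  have hgg' : ∀ s ∈ Icc 0 t, g' s = g s := fun s hs => IccExtend_of_mem ht _ hs
  set G : ℝ → ℝ := fun s => g' s - g t with hG
  have hGc : Continuous G := by fun_prop
  have hcs : ∀ s ∈ Icc c t, s ∈ Icc 0 t := fun s hs => ⟨hc.trans hs.1, hs.2⟩
  have htm : t ∈ Icc 0 t := ⟨ht, le_rfl⟩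
  have hGt : G t = 0 := by simp only [hG]; rw [hgg' t htm, sub_self]
  have hKG : ∀ s ∈ Icc c t, ∀ r ∈ Icc c t, |G s - G r| ≤ K * |s - r| ^ γ := by
    intro s hs r hr
    simp only [hG]
    rw [sub_sub_sub_cancel_right, hgg' s (hcs s hs), hgg' r (hcs r hr)]
    exact hK s hs r hr
  have hW : ∀ s ∈ Ioo 0 t, weylRight (1 - β) t (fun r => g r - g t) s =
      weylRight (1 - β) t G s := by
    intro s hs
    have hs' : s ∈ Icc 0 t := Ioo_subset_Icc_self hs
    unfold weylRight
    simp only [hG]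
    rw [hgg' s hs']
    congr 3
    refine setIntegral_congr_fun measurableSet_Ioo (fun u hu => ?_)
    rw [hgg' u ⟨hs.1.le.trans hu.1.le, hu.2.le⟩]
  obtain ⟨M, hM0, hM⟩ := exists_bound_weylRight h1 hγ hKG hGt
  have hWm : Measurable (weylRight (1 - β) t G) := measurable_weylRight hGc.measurable
  -- Before `c` the right derivative is not known to be bounded, but there the left derivative of
  -- every step vanishes.
  have hprod : ∀ p, ∀ s ∈ Ioo 0 t, ‖weylLeft β (φ p) s * weylRight (1 - β) t G s‖ₑ ≤
      ‖weylLeft β (φ p) s‖ₑ * ENNReal.ofReal M := by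
    intro p s hs
    rw [enorm_mul]
    rcases le_or_gt s c with h | h
    · have : weylLeft β (φ p) s = 0 := by
        simp only [hφ]
        rw [weylLeft_indicator h0 (hc.trans (hl p)) (hlr p)]
        unfold plusPow
        rw [indicator_of_notMem (by simpa using h.trans (hl p)),
          indicator_of_notMem (by simpa using h.trans ((hl p).trans (hlr p)))]
        simp
      rw [this]; simp
    · gcongr
      rw [← ofReal_norm]
      exact ENNReal.ofReal_le_ofReal (hM s ⟨h, hs.2⟩)
  have hnorm : ∑' p, ∫⁻ s in Ioo 0 t,
      ‖θ p * (weylLeft β (φ p) s * weylRight (1 - β) t G s)‖ₑ ≠ ∞ := by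
    have hfinal : ∑' p, ‖θ p‖ₑ * besovNorm β t (φ p) *
        (ENNReal.ofReal (1 / Real.Gamma (1 - β)) * ENNReal.ofReal M) ≠ ∞ := by
      rw [ENNReal.tsum_mul_right]
      exact ENNReal.mul_ne_top hBesov (by finiteness)
    refine ne_top_of_le_ne_top hfinal (ENNReal.tsum_le_tsum fun p => ?_)
    simp_rw [enorm_mul (θ p)]
    rw [lintegral_const_mul' _ _ (by simp), mul_assoc]
    gcongr
    refine (setLIntegral_mono' measurableSet_Ioo (hprod p)).trans ?_
    rw [lintegral_mul_const' _ _ (by simp), ← mul_assoc]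
    gcongr
    rw [mul_comm]
    exact lintegral_enorm_weylLeft_le (hφm p) h0 h1
  have hae : ∀ᵐ s ∂(volume.restrict (Ioo 0 t)),
      weylLeft β f s * weylRight (1 - β) t (fun r => g r - g t) s =
        ∑' p, θ p * (weylLeft β (φ p) s * weylRight (1 - β) t G s) := by
    have hfin2 : ∫⁻ s in Ioo 0 t, ∑' p, ‖θ p‖ₑ * besovInner β (φ p) s ≠ ∞ := by
      rw [lintegral_tsum (fun p => ((measurable_besovInner (hφm p)).const_mul _).aemeasurable)]
      refine ne_top_of_le_ne_top hBesov (ENNReal.tsum_le_tsum fun p => ?_)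
      rw [lintegral_const_mul' _ _ (by simp)]
      gcongr
      exact le_add_self
    have hmeas : Measurable (fun s => ∑' p, ‖θ p‖ₑ * besovInner β (φ p) s) :=
      Measurable.tsum (fun p => (measurable_besovInner (hφm p)).const_mul _)
    filter_upwards [ae_lt_top hmeas hfin2, ae_restrict_mem measurableSet_Ioo] with s hs hst
    rw [hW s hst, weylLeft_tsum hφm hfin hs.ne, ← tsum_mul_right]
    congr 1; ext p; ring
  have hterm : ∀ p, Measurable
      (fun s => θ p * (weylLeft β (φ p) s * weylRight (1 - β) t G s)) := fun p =>
    ((measurable_weylLeft (hφm p)).mul hWm).const_mul _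
  have hintser : Integrable (fun s => ∑' p, θ p * (weylLeft β (φ p) s *
      weylRight (1 - β) t G s)) (volume.restrict (Ioo 0 t)) := by
    refine ⟨(Measurable.tsum hterm).aestronglyMeasurable, ?_⟩
    refine (lintegral_mono (fun s => enorm_tsum_le_tsum_enorm)).trans_lt ?_
    rw [lintegral_tsum (fun p => (hterm p).enorm.aemeasurable)]
    exact lt_top_iff_ne_top.2 hnorm
  refine ⟨⟨h0, h1⟩, ⟨hfm.comp measurable_subtype_coe, hfB⟩, hg, hconv, ?_, ?_⟩
  · exact hintser.congr (hae.mono fun s hs => hs.symm)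
  · rw [integral_congr_ae hae, integral_tsum (fun p => (hterm p).aestronglyMeasurable) hnorm,
      ← tsum_neg]
    congr 1; ext p
    rw [integral_const_mul, integral_weyl_indicator hGc h0 h1 hγ hc (hl p) (hlr p) (hr p) hKG hGt]
    simp only [hG]
    rw [hgg' (l p) ⟨hc.trans (hl p), (hlr p).trans (hr p)⟩,
      hgg' (r p) ⟨hc.trans ((hl p).trans (hlr p)), hr p⟩]
    ring

end StepGLS

/-! ### The two discrete mechanisms: gain of a stopped strategy, contraction of the error. -/

section Discrete

/-- Trading `2 x_i` until the first exit from `[-ρ, ρ]` gains `ρ²` up to a relative error `1/8`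
if the path exits and its quadratic variation is small. -/
lemma abs_sum_stopped_sub_one_le {x : ℕ → ℝ} {m : ℕ} {ρ w : ℝ} (hρ : 0 < ρ) (hx0 : x 0 = 0)
    (hw : ∀ i < m, |x (i + 1) - x i| ≤ w) (hexit : ∃ j, j ≤ m ∧ ρ < |x j|)
    (hq : m * w ^ 2 ≤ ρ ^ 2 / 400) :
    |∑ i ∈ Finset.range m, 2 / ρ ^ 2 * x i * {i | ∀ j ≤ i, |x j| ≤ ρ}.indicator 1 i *
      (x (i + 1) - x i) - 1| ≤ 1 / 8 := by
  classical
  have hex : ∃ j, ρ < |x j| := hexit.imp fun j h => h.2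
  set σ := Nat.find hex with hσ
  have hσx : ρ < |x σ| := Nat.find_spec hex
  have hσm : σ ≤ m := by
    obtain ⟨j, hj, hjx⟩ := hexit
    exact (Nat.find_min' hex hjx).trans hj
  have hσ0 : 0 < σ := by
    rcases Nat.eq_zero_or_pos σ with h | h
    · rw [h, hx0, abs_zero] at hσx; linarith
    · exact h
  have hlt : ∀ j < σ, |x j| ≤ ρ := fun j hj => not_lt.1 (Nat.find_min hex hj)
  have hstay : ∀ i, i ∈ {i | ∀ j ≤ i, |x j| ≤ ρ} ↔ i < σ := by
    intro i
    constructor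
    · intro h
      by_contra hc
      exact absurd (h σ (not_lt.1 hc)) (not_le.2 hσx)
    · intro h j hj
      exact hlt j (by omega)
  have hsum : ∑ i ∈ Finset.range m, 2 / ρ ^ 2 * x i * {i | ∀ j ≤ i, |x j| ≤ ρ}.indicator 1 i *
      (x (i + 1) - x i) =
      (x σ ^ 2 - ∑ i ∈ Finset.range σ, (x (i + 1) - x i) ^ 2) / ρ ^ 2 := by
    rw [← Finset.sum_subset (Finset.range_subset_range.2 hσm)]
    · have htel := Finset.sum_range_sub (fun i => x i ^ 2) σ
      simp only [hx0] at htel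
      have : x σ ^ 2 = ∑ i ∈ Finset.range σ, (x (i + 1) ^ 2 - x i ^ 2) := by rw [htel]; ring
      rw [this, ← Finset.sum_sub_distrib, Finset.sum_div]
      refine Finset.sum_congr rfl (fun i hi => ?_)
      rw [indicator_of_mem ((hstay i).2 (Finset.mem_range.1 hi))]
      simp only [Pi.one_apply]
      ring
    · intro i _ hi
      rw [indicator_of_notMem (fun h => hi (Finset.mem_range.2 ((hstay i).1 h)))]
      ring
  have hw0 : 0 ≤ w := (abs_nonneg _).trans (hw 0 (by omega))
  have hm1 : (1 : ℝ) ≤ m := by exact_mod_cast (show 1 ≤ m by omega)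
  -- A single step already satisfies `w² ≤ ρ²/400`, so the overshoot at the exit is at most `ρ/20`.
  -- The normalised gain then lies between `1 - 1/400` and `441/400`, within `1/8` of 1.
  have hwρ : w ≤ ρ / 20 := by
    have : w ^ 2 ≤ (ρ / 20) ^ 2 := by nlinarith [sq_nonneg w]
    exact (pow_le_pow_iff_left₀ hw0 (by positivity) two_ne_zero).1 this
  have hup : |x σ| ≤ ρ + w := by
    have h1 := hlt (σ - 1) (by omega)
    have h2 := hw (σ - 1) (by omega)
    rw [Nat.sub_add_cancel hσ0] at h2
    have := abs_sub_abs_le_abs_sub (x σ) (x (σ - 1))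
    linarith
  have hqv : ∑ i ∈ Finset.range σ, (x (i + 1) - x i) ^ 2 ≤ ρ ^ 2 / 400 := by
    calc _ ≤ ∑ i ∈ Finset.range σ, w ^ 2 := by
          refine Finset.sum_le_sum (fun i hi => ?_)
          rw [← sq_abs]
          have := hw i ((Finset.mem_range.1 hi).trans_le hσm)
          gcongr
      _ = σ * w ^ 2 := by simp
      _ ≤ m * w ^ 2 := by gcongr
      _ ≤ _ := hq
  have hqv0 : 0 ≤ ∑ i ∈ Finset.range σ, (x (i + 1) - x i) ^ 2 :=
    Finset.sum_nonneg (fun i _ => sq_nonneg _)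
  have hlo2 : ρ ^ 2 ≤ x σ ^ 2 := by rw [← sq_abs (x σ)]; gcongr
  have hup2 : x σ ^ 2 ≤ ρ ^ 2 * (441 / 400) := by
    rw [← sq_abs (x σ)]
    calc |x σ| ^ 2 ≤ (ρ + ρ / 20) ^ 2 := by gcongr; linarith
      _ = _ := by ring
  rw [hsum, div_sub_one (by positivity), abs_le]
  constructor
  · rw [le_div_iff₀ (by positivity)]; nlinarith [sq_nonneg ρ]
  · rw [div_le_iff₀ (by positivity)]; nlinarith [sq_nonneg ρ]

/-- A linear recursion that eventually contracts by `1/8` with a geometric forcing term decays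
geometrically. -/
lemma exists_bound_of_recursion {e G d : ℕ → ℝ} {L r : ℝ} {N : ℕ} (hr : 1 / 2 ≤ r) (hL : 0 ≤ L)
    (he : ∀ n, e (n + 1) = e n * (1 - G n) + d n) (hd : ∀ n, |d n| ≤ L * r ^ n)
    (hG : ∀ n ≥ N, |G n - 1| ≤ 1 / 8) : ∃ B, 0 ≤ B ∧ ∀ n, |e n| ≤ B * r ^ n := by
  have hr0 : 0 < r := by linarith
  have hnn : ∀ k ∈ Finset.range (N + 1), 0 ≤ |e k| / r ^ k := fun k _ => by positivity
  -- The sum covers the initial terms, up to and including `N`. Afterwards `3 L ≤ B` gives `B/8 + L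
  -- ≤ B/2`, and `1/2 ≤ r` closes the induction.
  set B := 3 * L + ∑ k ∈ Finset.range (N + 1), |e k| / r ^ k with hB
  have hB0 : 3 * L ≤ B := le_add_of_nonneg_right (Finset.sum_nonneg hnn)
  refine ⟨B, by linarith, fun n => ?_⟩
  induction n with
  | zero =>
    have h2 := Finset.single_le_sum hnn (Finset.mem_range.2 (Nat.succ_pos N))
    simp only [pow_zero, div_one] at h2 ⊢
    linarith
  | succ n ih =>
    rcases lt_or_ge n N with h | h
    · rw [← div_le_iff₀ (by positivity)]
      have h2 := Finset.single_le_sum hnn (Finset.mem_range.2 (show n + 1 < N + 1 by omega))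
      linarith
    · rw [he n]
      have h1 : |e n * (1 - G n)| ≤ B * r ^ n * (1 / 8) := by
        rw [abs_mul, abs_sub_comm]
        gcongr
        exact hG n h
      have h2 := abs_add_le (e n * (1 - G n)) (d n)
      have h3 := hd n
      have hp : 0 < r ^ n := by positivity
      rw [pow_succ]
      have h4 : B * r ^ n * (1 / 8) + L * r ^ n ≤ B * r ^ n * (1 / 2) := by nlinarith
      have hB1 : 0 ≤ B := by linarith
      have h5 : B * r ^ n * (1 / 2) ≤ B * r ^ n * r := by gcongr
      linarith

end Discrete

/-! ### The dyadic times, the grid and the strategy. -/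

section Strategy

/-- The times `t_n = t - D / 2^n` increasing to `t`. -/
noncomputable def dyadicTime (t D : ℝ) (n : ℕ) : ℝ := t - D / 2 ^ n

/-- The length of the `n`-th dyadic interval. -/
noncomputable def dyadicLen (D : ℝ) (n : ℕ) : ℝ := D / 2 ^ (n + 1)

/-- The number of cells into which the `n`-th dyadic interval is divided. -/
noncomputable def cellCount (D κ : ℝ) (n : ℕ) : ℕ := ⌈dyadicLen D n ^ (-κ)⌉₊

/-- The length of a cell of the `n`-th dyadic interval. -/
noncomputable def cellLen (D κ : ℝ) (n : ℕ) : ℝ := dyadicLen D n / cellCount D κ n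

/-- The grid points of the `n`-th dyadic interval. -/
noncomputable def node (t D κ : ℝ) (n i : ℕ) : ℝ := dyadicTime t D n + i * cellLen D κ n

variable {t D κ : ℝ}

lemma dyadicLen_pos (hD : 0 < D) (n : ℕ) : 0 < dyadicLen D n := by
  unfold dyadicLen; positivity

lemma dyadicTime_add (t D : ℝ) (n : ℕ) :
    dyadicTime t D n + dyadicLen D n = dyadicTime t D (n + 1) := by
  unfold dyadicTime dyadicLen; rw [pow_succ]; field_simp; ring

lemma dyadicLen_eq (D : ℝ) (n : ℕ) : dyadicLen D n = D / 2 * (1 / 2) ^ n := by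
  unfold dyadicLen; rw [pow_succ, one_div, inv_pow]; field_simp

lemma dyadicLen_le (hD : 0 < D) (n : ℕ) : dyadicLen D n ≤ D := by
  unfold dyadicLen
  exact div_le_self hD.le (one_le_pow₀ one_le_two)

lemma tendsto_dyadicLen (D : ℝ) : Tendsto (dyadicLen D) atTop (𝓝 0) := by
  have := (tendsto_pow_atTop_nhds_zero_of_lt_one (by norm_num : (0 : ℝ) ≤ 1 / 2)
    (by norm_num)).const_mul (D / 2)
  rw [mul_zero] at this
  exact this.congr (fun n => (dyadicLen_eq D n).symm)

lemma dyadicTime_lt (hD : 0 < D) (n : ℕ) : dyadicTime t D n < t := by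
  unfold dyadicTime
  have : 0 < D / 2 ^ n := by positivity
  linarith

lemma le_dyadicTime (hD : 0 < D) (n : ℕ) : t - D ≤ dyadicTime t D n := by
  unfold dyadicTime
  have : D / 2 ^ n ≤ D := div_le_self hD.le (one_le_pow₀ one_le_two)
  linarith

lemma dyadicTime_mono (hD : 0 < D) : Monotone (dyadicTime t D) :=
  monotone_nat_of_le_succ fun n => by
    rw [← dyadicTime_add]; linarith [dyadicLen_pos hD n]

lemma tendsto_dyadicTime (t D : ℝ) : Tendsto (dyadicTime t D) atTop (𝓝 t) := by
  have h := (tendsto_const_nhds (x := t)).sub ((tendsto_dyadicLen D).const_mul 2)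
  rw [mul_zero, sub_zero] at h
  refine h.congr (fun n => ?_)
  unfold dyadicTime dyadicLen; rw [pow_succ]; field_simp

lemma rpow_le_cellCount (D κ : ℝ) (n : ℕ) : dyadicLen D n ^ (-κ) ≤ cellCount D κ n :=
  Nat.le_ceil _

lemma cellCount_pos (hD : 0 < D) (κ : ℝ) (n : ℕ) : (0 : ℝ) < cellCount D κ n :=
  (Real.rpow_pos_of_pos (dyadicLen_pos hD n) _).trans_le (rpow_le_cellCount D κ n)

lemma one_le_cellCount (hD : 0 < D) (κ : ℝ) (n : ℕ) : (1 : ℝ) ≤ cellCount D κ n := by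
  have : 0 < cellCount D κ n := by exact_mod_cast cellCount_pos hD κ n
  exact_mod_cast this

/-- Since `D ≤ 1`, the number being rounded up is at least 1, so rounding at most doubles it. -/
lemma cellCount_le (hD : 0 < D) (hD1 : D ≤ 1) (hκ : 0 < κ) (n : ℕ) :
    (cellCount D κ n : ℝ) ≤ 2 * dyadicLen D n ^ (-κ) := by
  have h1 : 1 ≤ dyadicLen D n ^ (-κ) :=
    Real.one_le_rpow_of_pos_of_le_one_of_nonpos (dyadicLen_pos hD n)
      ((dyadicLen_le hD n).trans hD1) (by linarith)
  have := Nat.ceil_lt_add_one (show 0 ≤ dyadicLen D n ^ (-κ) by linarith)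
  unfold cellCount
  linarith

lemma cellLen_pos (hD : 0 < D) (κ : ℝ) (n : ℕ) : 0 < cellLen D κ n :=
  div_pos (dyadicLen_pos hD n) (cellCount_pos hD κ n)

lemma cellLen_le (hD : 0 < D) (κ : ℝ) (n : ℕ) : cellLen D κ n ≤ dyadicLen D n :=
  div_le_self (dyadicLen_pos hD n).le (one_le_cellCount hD κ n)

lemma node_zero (t D κ : ℝ) (n : ℕ) : node t D κ n 0 = dyadicTime t D n := by
  simp [node]

lemma node_cellCount (hD : 0 < D) (t κ : ℝ) (n : ℕ) :
    node t D κ n (cellCount D κ n) = dyadicTime t D (n + 1) := by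
  unfold node cellLen
  rw [mul_div_cancel₀ _ (cellCount_pos hD κ n).ne', dyadicTime_add]

lemma node_succ_sub (t D κ : ℝ) (n i : ℕ) :
    node t D κ n (i + 1) - node t D κ n i = cellLen D κ n := by
  unfold node; push_cast; ring

lemma node_mono (hD : 0 < D) (t κ : ℝ) (n : ℕ) : Monotone (node t D κ n) :=
  monotone_nat_of_le_succ fun i => by
    linarith [node_succ_sub t D κ n i, cellLen_pos hD κ n]

lemma le_node (hD : 0 < D) (κ : ℝ) (n i : ℕ) : dyadicTime t D n ≤ node t D κ n i := by
  rw [← node_zero t D κ]; exact node_mono hD t κ n (Nat.zero_le i)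

lemma node_le (hD : 0 < D) (κ : ℝ) {n i : ℕ} (hi : i ≤ cellCount D κ n) :
    node t D κ n i ≤ dyadicTime t D (n + 1) := by
  rw [← node_cellCount hD]; exact node_mono hD t κ n hi

lemma node_mem (hD : 0 < D) {n i : ℕ} (hi : i ≤ cellCount D κ n) :
    node t D κ n i ∈ Icc (t - D) t :=
  ⟨(le_dyadicTime hD n).trans (le_node hD κ n i),
    (node_le hD κ hi).trans (dyadicTime_lt hD _).le⟩

/-- The cells are pairwise disjoint. -/
lemma cell_unique (hD : 0 < D) {s : ℝ} {p q : Σ n, Fin (cellCount D κ n)}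
    (hp : s ∈ Ioc (node t D κ p.1 p.2) (node t D κ p.1 (p.2 + 1)))
    (hq : s ∈ Ioc (node t D κ q.1 q.2) (node t D κ q.1 (q.2 + 1))) : p = q := by
  have aux : ∀ n k i j : ℕ, i < cellCount D κ n →
      s ∈ Ioc (node t D κ n i) (node t D κ n (i + 1)) →
      s ∈ Ioc (node t D κ k j) (node t D κ k (j + 1)) → ¬ n < k := by
    intro n k i j hi h1 h2 hnk
    have h3 := (node_le (t := t) hD κ (Nat.succ_le_of_lt hi)).trans
      ((dyadicTime_mono hD (Nat.succ_le_of_lt hnk)).trans (le_node hD κ k j))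
    linarith [h1.2, h2.1]
  have aux2 : ∀ n i j : ℕ, s ∈ Ioc (node t D κ n i) (node t D κ n (i + 1)) →
      s ∈ Ioc (node t D κ n j) (node t D κ n (j + 1)) → ¬ i < j := by
    intro n i j h1 h2 hij
    have h3 := node_mono hD t κ n (Nat.succ_le_of_lt hij)
    linarith [h1.2, h2.1]
  obtain ⟨n, i, hi⟩ := p
  obtain ⟨k, j, hj⟩ := q
  have h1 := aux n k i j hi hp hq
  have h2 := aux k n j i hj hq hp
  obtain rfl : n = k := by omega
  have h3 := aux2 n i j hp hq
  have h4 := aux2 n j i hq hp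
  obtain rfl : i = j := by omega
  rfl

/-- The exit threshold on the `n`-th dyadic interval. -/
noncomputable def threshold (D a : ℝ) (n : ℕ) : ℝ := dyadicLen D n ^ a / 2

/-- The position on the `i`-th cell of the `n`-th dyadic interval, per unit of target. -/
noncomputable def unitPosition (t D κ a : ℝ) (x : ℝ → ℝ) (n i : ℕ) : ℝ :=
  2 / threshold D a n ^ 2 * (x (node t D κ n i) - x (node t D κ n 0)) *
    {i | ∀ j ≤ i, |x (node t D κ n j) - x (node t D κ n 0)| ≤ threshold D a n}.indicator 1 i

/-- The gain over the `n`-th dyadic interval, per unit of target. -/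
noncomputable def unitGain (t D κ a : ℝ) (x : ℝ → ℝ) (n : ℕ) : ℝ :=
  ∑ i ∈ Finset.range (cellCount D κ n),
    unitPosition t D κ a x n i * (x (node t D κ n (i + 1)) - x (node t D κ n i))

/-- The distance of the running integral to the current value of `z` at the time `t_n`. -/
noncomputable def target (t D κ a : ℝ) (x z : ℝ → ℝ) : ℕ → ℝ
  | 0 => z (dyadicTime t D 0)
  | n + 1 => target t D κ a x z n * (1 - unitGain t D κ a x n) +
      (z (dyadicTime t D (n + 1)) - z (dyadicTime t D n))

/-- The position on a cell. -/
noncomputable def position (t D κ a : ℝ) (x z : ℝ → ℝ) (p : Σ n, Fin (cellCount D κ n)) : ℝ :=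
  target t D κ a x z p.1 * unitPosition t D κ a x p.1 p.2

/-- The integrand: constant on each cell, and zero outside of the cells. -/
noncomputable def integrand (t D κ a : ℝ) (x z : ℝ → ℝ) (s : ℝ) : ℝ :=
  ∑' p : Σ n, Fin (cellCount D κ n), position t D κ a x z p *
    (Ioc (node t D κ p.1 p.2) (node t D κ p.1 (p.2 + 1))).indicator 1 s

variable {a : ℝ} {x z : ℝ → ℝ}

lemma threshold_pos (hD : 0 < D) (a : ℝ) (n : ℕ) : 0 < threshold D a n :=
  half_pos (Real.rpow_pos_of_pos (dyadicLen_pos hD n) _)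

lemma abs_unitPosition_le (hD : 0 < D) (n i : ℕ) :
    |unitPosition t D κ a x n i| ≤ 2 / threshold D a n := by
  have hρ := threshold_pos hD a n
  unfold unitPosition
  by_cases h : i ∈ {i | ∀ j ≤ i, |x (node t D κ n j) - x (node t D κ n 0)| ≤ threshold D a n}
  · rw [indicator_of_mem h, Pi.one_apply, mul_one, abs_mul, abs_of_pos (by positivity)]
    calc _ ≤ 2 / threshold D a n ^ 2 * threshold D a n := by
          gcongr
          exact h i le_rfl
      _ = _ := by field_simp
  · rw [indicator_of_notMem h, mul_zero, abs_zero]; positivity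

/-- On a Hölder path that leaves the ball of radius `2ρ` and whose quadratic variation along the
grid is small, the gain is close to one. -/
lemma abs_unitGain_sub_one_le (hD : 0 < D) {γ K : ℝ} (hγ : 0 < γ)
    (hK0 : 0 ≤ K)
    (hK : ∀ s ∈ Icc (t - D) t, ∀ r ∈ Icc (t - D) t, |x s - x r| ≤ K * |s - r| ^ γ) {n : ℕ}
    (hexit : ∃ u ∈ Icc (dyadicTime t D n) (dyadicTime t D (n + 1)),
      2 * threshold D a n < |x u - x (dyadicTime t D n)|)
    (hq : cellCount D κ n * (K * cellLen D κ n ^ γ) ^ 2 ≤ threshold D a n ^ 2 / 400) :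
    |unitGain t D κ a x n - 1| ≤ 1 / 8 := by
  set ρ := threshold D a n with hρ
  have hρ0 : 0 < ρ := threshold_pos hD a n
  have hh := cellLen_pos hD κ n
  set w := K * cellLen D κ n ^ γ with hw
  have hw0 : 0 ≤ w := by positivity
  have hwρ : w ≤ ρ := by
    have h1 := one_le_cellCount hD κ n
    have : w ^ 2 ≤ ρ ^ 2 := by nlinarith [sq_nonneg w, sq_nonneg ρ]
    exact (pow_le_pow_iff_left₀ hw0 hρ0.le two_ne_zero).1 this
  refine (le_of_eq ?_).trans (abs_sum_stopped_sub_one_le (w := w) (m := cellCount D κ n)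
    (x := fun i => x (node t D κ n i) - x (node t D κ n 0)) hρ0 (by simp) ?_ ?_ hq)
  · unfold unitGain unitPosition
    simp only [sub_sub_sub_cancel_right]
    rfl
  · intro i hi
    rw [sub_sub_sub_cancel_right]
    refine (hK _ (node_mem hD (Nat.succ_le_of_lt hi)) _ (node_mem hD hi.le)).trans (le_of_eq ?_)
    rw [node_succ_sub, abs_of_pos hh]
  -- The exit is known in continuous time but the strategy only looks at the grid. The last node
  -- before `u` is within one cell of it, where the path varies by at most `w ≤ ρ`; leaving the ball
  -- of radius `2ρ` thus forces a node outside the ball of radius `ρ`.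
  · obtain ⟨u, hu, hux⟩ := hexit
    have hu0 : 0 ≤ (u - dyadicTime t D n) / cellLen D κ n := div_nonneg (by linarith [hu.1]) hh.le
    set j := ⌊(u - dyadicTime t D n) / cellLen D κ n⌋₊ with hj
    have hj1 : (j : ℝ) * cellLen D κ n ≤ u - dyadicTime t D n := by
      rw [← le_div_iff₀ hh]; exact Nat.floor_le hu0
    have hj2 : u - dyadicTime t D n < (j + 1) * cellLen D κ n := by
      rw [← div_lt_iff₀ hh]; exact Nat.lt_floor_add_one _
    have hjm : j ≤ cellCount D κ n := by
      have h1 : (j : ℝ) * cellLen D κ n ≤ cellCount D κ n * cellLen D κ n := by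
        have h2 := node_cellCount hD t κ n
        unfold node at h2
        linarith [hu.2]
      exact_mod_cast le_of_mul_le_mul_right h1 hh
    refine ⟨j, hjm, ?_⟩
    have hum : u ∈ Icc (t - D) t := ⟨(le_dyadicTime hD n).trans hu.1,
      hu.2.trans (dyadicTime_lt hD _).le⟩
    have h3 := hK u hum _ (node_mem (κ := κ) hD hjm)
    have h4 : |u - node t D κ n j| ≤ cellLen D κ n := by
      unfold node; rw [abs_le]; constructor <;> linarith
    have h5 : |x u - x (node t D κ n j)| ≤ w := h3.trans (by simp only [hw]; gcongr)
    rw [node_zero]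
    have := abs_sub_le (x u) (x (node t D κ n j)) (x (dyadicTime t D n))
    linarith

end Strategy

/-! ### Pathwise analysis: error decay, summability of the positions, total gain. -/

section StrategyPath

variable {t D κ a : ℝ} {x z : ℝ → ℝ}

lemma dyadicLen_rpow (hD : 0 < D) (e : ℝ) (n : ℕ) :
    dyadicLen D n ^ e = (D / 2) ^ e * ((1 / 2 : ℝ) ^ e) ^ n := by
  rw [dyadicLen_eq, Real.mul_rpow (by positivity) (by positivity), ← Real.rpow_natCast,
    ← Real.rpow_natCast, ← Real.rpow_mul (by norm_num), ← Real.rpow_mul (by norm_num), mul_comm e]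

lemma dyadicLen_le_pow (hD1 : D ≤ 1) (n : ℕ) : dyadicLen D n ≤ (1 / 2) ^ n := by
  rw [dyadicLen_eq]
  exact mul_le_of_le_one_left (by positivity) (by linarith)

lemma tendsto_dyadicLen_rpow (hD : 0 < D) {e : ℝ} (he : 0 < e) :
    Tendsto (fun n => dyadicLen D n ^ e) atTop (𝓝 0) := by
  have h := tendsto_pow_atTop_nhds_zero_of_lt_one (by positivity : (0 : ℝ) ≤ (1 / 2) ^ e)
    (Real.rpow_lt_one (by norm_num) (by norm_num) he)
  simp_rw [dyadicLen_rpow hD]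
  simpa using h.const_mul ((D / 2) ^ e)

/-- Quadratic variations along the grid are eventually small compared to the thresholds. -/
lemma eventually_quadratic_le (hD : 0 < D) {γ K : ℝ} (hγ : 1 / 2 < γ)
    (he : 0 < 2 * γ + κ * (2 * γ - 1) - 2 * a) :
    ∀ᶠ n in atTop, cellCount D κ n * (K * cellLen D κ n ^ γ) ^ 2 ≤ threshold D a n ^ 2 / 400 := by
  have h1 := (tendsto_dyadicLen_rpow hD he).const_mul (K ^ 2)
  rw [mul_zero] at h1
  filter_upwards [h1.eventually (ge_mem_nhds (show (0 : ℝ) < 1 / 1600 by norm_num))] with n hn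
  set Δ := dyadicLen D n with hΔ
  have hΔ0 : 0 < Δ := dyadicLen_pos hD n
  have hm := cellCount_pos hD κ n
  set m : ℝ := ((cellCount D κ n : ℕ) : ℝ)
  have hmle : Δ ^ (-κ) ≤ m := rpow_le_cellCount D κ n
  -- Here `2γ > 1` makes refinement useful: with `m ≥ Δ^(-κ)` cells the quadratic variation gains a
  -- factor `Δ^(κ(2γ-1))`. A single cell would give only `Δ^(2γ)`, too large against `Δ^(2a)` when
  -- `γ < a`.
  have e1 : m * (cellLen D κ n ^ γ) ^ 2 = m ^ (1 - 2 * γ) * Δ ^ (2 * γ) := by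
    unfold cellLen
    rw [← Real.rpow_natCast, ← Real.rpow_mul (by positivity), Real.div_rpow hΔ0.le hm.le,
      Real.rpow_sub hm, Real.rpow_one]
    have : γ * ((2 : ℕ) : ℝ) = 2 * γ := by push_cast; ring
    rw [this]; ring
  have e2 : m ^ (1 - 2 * γ) ≤ Δ ^ (κ * (2 * γ - 1)) := by
    refine (Real.rpow_le_rpow_of_nonpos (by positivity) hmle (by linarith)).trans (le_of_eq ?_)
    rw [← Real.rpow_mul hΔ0.le]; congr 1; ring
  have e3 : threshold D a n ^ 2 / 400 = Δ ^ (2 * a) * (1 / 1600) := by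
    unfold threshold
    rw [div_pow, ← Real.rpow_natCast, ← Real.rpow_mul hΔ0.le]
    have : a * ((2 : ℕ) : ℝ) = 2 * a := by push_cast; ring
    rw [this]; ring
  rw [mul_pow, e3]
  calc m * (K ^ 2 * (cellLen D κ n ^ γ) ^ 2) = K ^ 2 * (m ^ (1 - 2 * γ) * Δ ^ (2 * γ)) := by
        rw [← e1]; ring
    _ ≤ K ^ 2 * (Δ ^ (κ * (2 * γ - 1)) * Δ ^ (2 * γ)) := by gcongr
    _ = Δ ^ (2 * a) * (K ^ 2 * Δ ^ (2 * γ + κ * (2 * γ - 1) - 2 * a)) := by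
        rw [← Real.rpow_add hΔ0, mul_left_comm, ← Real.rpow_add hΔ0]
        congr 2; ring
    _ ≤ _ := by gcongr

/-- The target decays geometrically. -/
lemma exists_target_bound (hD : 0 < D) (hD1 : D ≤ 1) {γ K b L : ℝ} (hγ : 1 / 2 < γ)
    (he : 0 < 2 * γ + κ * (2 * γ - 1) - 2 * a) (hK0 : 0 ≤ K)
    (hK : ∀ s ∈ Icc (t - D) t, ∀ r ∈ Icc (t - D) t, |x s - x r| ≤ K * |s - r| ^ γ)
    (hb0 : 0 ≤ b) (hb1 : b ≤ 1) (hL : 0 ≤ L)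
    (hz : ∀ s ∈ Icc (t - D) t, ∀ r ∈ Icc (t - D) t, |z s - z r| ≤ L * |s - r| ^ b)
    (hexit : ∀ᶠ n in atTop, ∃ u ∈ Icc (dyadicTime t D n) (dyadicTime t D (n + 1)),
      2 * threshold D a n < |x u - x (dyadicTime t D n)|) :
    ∃ B, 0 ≤ B ∧ ∀ n, |target t D κ a x z n| ≤ B * ((1 / 2 : ℝ) ^ b) ^ n := by
  obtain ⟨N, hN⟩ := eventually_atTop.1 (hexit.and (eventually_quadratic_le (K := K) hD hγ he))
  have hTm : ∀ n, dyadicTime t D n ∈ Icc (t - D) t := fun n =>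
    ⟨le_dyadicTime hD n, (dyadicTime_lt hD n).le⟩
  refine exists_bound_of_recursion (G := unitGain t D κ a x) (N := N) (L := L)
    (d := fun n => z (dyadicTime t D (n + 1)) - z (dyadicTime t D n)) ?_ hL (fun n => rfl)
    (fun n => ?_) (fun n hn => ?_)
  · calc (1 / 2 : ℝ) = (1 / 2) ^ (1 : ℝ) := (Real.rpow_one _).symm
      _ ≤ (1 / 2) ^ b := Real.rpow_le_rpow_of_exponent_ge (by norm_num) (by norm_num) hb1
  · refine (hz _ (hTm _) _ (hTm _)).trans ?_
    have h1 := dyadicTime_add t D n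
    have h2 : dyadicTime t D (n + 1) - dyadicTime t D n = dyadicLen D n := by linarith
    rw [h2, abs_of_pos (dyadicLen_pos hD n)]
    gcongr
    calc dyadicLen D n ^ b ≤ ((1 / 2 : ℝ) ^ n) ^ b := by
          gcongr
          · exact (dyadicLen_pos hD n).le
          · exact dyadicLen_le_pow hD1 n
      _ = _ := by
          rw [← Real.rpow_natCast, ← Real.rpow_natCast, ← Real.rpow_mul (by norm_num),
            ← Real.rpow_mul (by norm_num), mul_comm]
  · exact abs_unitGain_sub_one_le hD (by linarith) hK0 hK (hN n hn).1 (hN n hn).2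

/-- The positions are summable against powers of the cell lengths. -/
lemma summable_position (hD : 0 < D) (hD1 : D ≤ 1) (hκ : 0 < κ) {b β B : ℝ} (hβ : β < 1)
    (he : 0 < b + 1 - β - κ - a) (hB0 : 0 ≤ B)
    (hB : ∀ n, |target t D κ a x z n| ≤ B * ((1 / 2 : ℝ) ^ b) ^ n) :
    Summable (fun p : Σ n, Fin (cellCount D κ n) => |position t D κ a x z p| *
      (node t D κ p.1 (p.2 + 1) - node t D κ p.1 p.2) ^ (1 - β)) := by
  simp_rw [node_succ_sub]
  rw [summable_sigma_of_nonneg (fun p => mul_nonneg (abs_nonneg _)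
    (Real.rpow_nonneg (cellLen_pos hD κ _).le _))]
  refine ⟨fun n => (hasSum_fintype _).summable, ?_⟩
  simp_rw [tsum_fintype]
  -- Exponent of `Δ` at level `n`: `1 - β` from the Besov norm of a cell, `-κ` from the number of
  -- cells, `-a` from the size of a unit position. The target supplies the further `2^(-b n)`.
  set e := 1 - β - κ - a with hee
  have hgeo : Summable (fun n : ℕ => 8 * B * (D / 2) ^ e * ((1 / 2 : ℝ) ^ (b + e)) ^ n) := by
    refine (summable_geometric_of_lt_one (by positivity) ?_).mul_left _
    exact Real.rpow_lt_one (by norm_num) (by norm_num) (by simp only [hee]; linarith)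
  refine hgeo.of_nonneg_of_le (fun n => Finset.sum_nonneg fun i _ => mul_nonneg (abs_nonneg _)
    (Real.rpow_nonneg (cellLen_pos hD κ _).le _)) (fun n => ?_)
  set Δ := dyadicLen D n with hΔ
  have hΔ0 : 0 < Δ := dyadicLen_pos hD n
  have hβ' : 0 < 1 - β := by linarith
  have hthr : 2 / threshold D a n = 4 * Δ ^ (-a) := by
    unfold threshold; rw [← hΔ, Real.rpow_neg hΔ0.le]; field_simp; norm_num
  have hterm : ∀ i : Fin (cellCount D κ n), |position t D κ a x z ⟨n, i⟩| *
      cellLen D κ n ^ (1 - β) ≤ B * ((1 / 2 : ℝ) ^ b) ^ n * (4 * Δ ^ (-a)) * Δ ^ (1 - β) := by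
    intro i
    unfold position
    rw [abs_mul]
    have h1 := hB n
    have h2 := abs_unitPosition_le (t := t) (κ := κ) (x := x) (a := a) hD n i
    rw [hthr] at h2
    have h3 := cellLen_le hD κ n
    have h4 := (cellLen_pos hD κ n).le
    gcongr
  calc _ ≤ ∑ i : Fin (cellCount D κ n),
        B * ((1 / 2 : ℝ) ^ b) ^ n * (4 * Δ ^ (-a)) * Δ ^ (1 - β) :=
        Finset.sum_le_sum fun i _ => hterm i
    _ = cellCount D κ n * (B * ((1 / 2 : ℝ) ^ b) ^ n * (4 * Δ ^ (-a)) * Δ ^ (1 - β)) := by simp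
    _ ≤ (2 * Δ ^ (-κ)) * (B * ((1 / 2 : ℝ) ^ b) ^ n * (4 * Δ ^ (-a)) * Δ ^ (1 - β)) := by
        gcongr
        exact cellCount_le hD hD1 hκ n
    _ = 8 * B * ((1 / 2 : ℝ) ^ b) ^ n * (Δ ^ (1 - β) * Δ ^ (-κ) * Δ ^ (-a)) := by ring
    _ = 8 * B * ((1 / 2 : ℝ) ^ b) ^ n * Δ ^ e := by
        rw [← Real.rpow_add hΔ0, ← Real.rpow_add hΔ0]; congr 2
    _ = _ := by
        rw [hΔ, dyadicLen_rpow hD, Real.rpow_add (by norm_num) b e, mul_pow]; ring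

/-- The total gain is the terminal value of `z`. -/
lemma tsum_position_mul_sub (hD : 0 < D) (hD1 : D ≤ 1) {b β B γ K : ℝ}
    (hγ : 1 - β ≤ γ) (hb : 0 < b) (hK0 : 0 ≤ K)
    (hB : ∀ n, |target t D κ a x z n| ≤ B * ((1 / 2 : ℝ) ^ b) ^ n)
    (hK : ∀ s ∈ Icc (t - D) t, ∀ r ∈ Icc (t - D) t, |x s - x r| ≤ K * |s - r| ^ γ)
    (hz : ContinuousWithinAt z (Icc (t - D) t) t)
    (hsum : Summable (fun p : Σ n, Fin (cellCount D κ n) => |position t D κ a x z p| *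
      (node t D κ p.1 (p.2 + 1) - node t D κ p.1 p.2) ^ (1 - β))) :
    ∑' p : Σ n, Fin (cellCount D κ n), position t D κ a x z p *
      (x (node t D κ p.1 (p.2 + 1)) - x (node t D κ p.1 p.2)) = z t := by
  have hS : Summable (fun p : Σ n, Fin (cellCount D κ n) => position t D κ a x z p *
      (x (node t D κ p.1 (p.2 + 1)) - x (node t D κ p.1 p.2))) := by
    -- Cells are shorter than 1 and `1 - β ≤ γ`, so an increment of `x` over a cell is at most `K`
    -- times the weight already known to be summable.
    refine Summable.of_norm_bounded (hsum.mul_left K) (fun p => ?_)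
    rw [norm_mul, Real.norm_eq_abs, mul_left_comm, node_succ_sub]
    gcongr
    have h1 := hK _ (node_mem (t := t) (κ := κ) hD (Nat.succ_le_of_lt p.2.2)) _
      (node_mem (t := t) hD p.2.2.le)
    rw [Nat.succ_eq_add_one, node_succ_sub, abs_of_pos (cellLen_pos hD κ _)] at h1
    refine h1.trans ?_
    gcongr 1
    exact Real.rpow_le_rpow_of_exponent_ge (cellLen_pos hD κ _)
      ((cellLen_le hD κ _).trans ((dyadicLen_le hD _).trans hD1)) hγ
  have hinner : ∀ n, ∑' i : Fin (cellCount D κ n), position t D κ a x z ⟨n, i⟩ *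
      (x (node t D κ n (i + 1)) - x (node t D κ n i)) =
      target t D κ a x z n * unitGain t D κ a x n := by
    intro n
    rw [tsum_fintype]
    unfold unitGain position
    rw [Finset.sum_range, Finset.mul_sum]
    simp_rw [mul_assoc]
  rw [hS.tsum_sigma]
  have hout := hS.sigma
  simp_rw [hinner] at hout ⊢
  -- The target recursion, started at `z` of the first time, is exactly the bookkeeping of current
  -- value minus accumulated gain.
  have hpartial : ∀ n, ∑ k ∈ Finset.range n, target t D κ a x z k * unitGain t D κ a x k =
      z (dyadicTime t D n) - target t D κ a x z n := by
    intro n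
    induction n with
    | zero => simp [target]
    | succ n ih => rw [Finset.sum_range_succ, ih, target]; ring
  have hlim1 := hout.hasSum.tendsto_sum_nat
  simp_rw [hpartial] at hlim1
  have htar : Tendsto (target t D κ a x z) atTop (𝓝 0) := by
    refine squeeze_zero_norm hB ?_
    simpa using (tendsto_pow_atTop_nhds_zero_of_lt_one
      (by positivity : (0 : ℝ) ≤ (1 / 2) ^ b)
      (Real.rpow_lt_one (by norm_num) (by norm_num) hb)).const_mul B
  have hzT : Tendsto (fun n => z (dyadicTime t D n)) atTop (𝓝 (z t)) :=
    hz.tendsto.comp (tendsto_nhdsWithin_iff.2 ⟨tendsto_dyadicTime t D,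
      Eventually.of_forall fun n => ⟨le_dyadicTime hD n, (dyadicTime_lt hD n).le⟩⟩)
  have hlim2 := hzT.sub htar
  rw [sub_zero] at hlim2
  exact tendsto_nhds_unique hlim1 hlim2

end StrategyPath

/-! ### Adaptedness of the strategy. -/

section StrategyMeasurable

variable {Ω : Type*} {t D κ a : ℝ}

lemma measurable_unitPosition {m : MeasurableSpace Ω} {x : Ω → ℝ → ℝ} {n i : ℕ}
    (hx : ∀ j ≤ i, Measurable (fun ω => x ω (node t D κ n j))) :
    Measurable (fun ω => unitPosition t D κ a (x ω) n i) := by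
  have hset : MeasurableSet {ω | ∀ j ≤ i,
      |x ω (node t D κ n j) - x ω (node t D κ n 0)| ≤ threshold D a n} := by
    have : {ω | ∀ j ≤ i, |x ω (node t D κ n j) - x ω (node t D κ n 0)| ≤ threshold D a n} =
        ⋂ j ∈ Finset.range (i + 1),
          {ω | |x ω (node t D κ n j) - x ω (node t D κ n 0)| ≤ threshold D a n} := by
      ext ω; simp
    rw [this]
    refine Finset.measurableSet_biInter _ (fun j hj => ?_)
    have h1 := hx j (Nat.lt_succ_iff.1 (Finset.mem_range.1 hj))
    have h0 := hx 0 (Nat.zero_le i)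
    exact measurableSet_le (h1.sub h0).abs measurable_const
  exact (((hx i le_rfl).sub (hx 0 (Nat.zero_le i))).const_mul _).mul
    (measurable_one.indicator hset)

lemma measurable_unitGain {m : MeasurableSpace Ω} {x : Ω → ℝ → ℝ} {n : ℕ}
    (hx : ∀ j ≤ cellCount D κ n, Measurable (fun ω => x ω (node t D κ n j))) :
    Measurable (fun ω => unitGain t D κ a (x ω) n) := by
  unfold unitGain
  refine Finset.measurable_fun_sum _ (fun i hi => ?_)
  have hi' := Finset.mem_range.1 hi
  exact (measurable_unitPosition fun j hj => hx j (hj.trans hi'.le)).mul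
    ((hx _ (Nat.succ_le_of_lt hi')).sub (hx _ hi'.le))

lemma measurable_target {m : MeasurableSpace Ω} {x z : Ω → ℝ → ℝ} {n : ℕ}
    (hx : ∀ k < n, ∀ j ≤ cellCount D κ k, Measurable (fun ω => x ω (node t D κ k j)))
    (hz : ∀ k ≤ n, Measurable (fun ω => z ω (dyadicTime t D k))) :
    Measurable (fun ω => target t D κ a (x ω) (z ω) n) := by
  induction n with
  | zero => exact hz 0 le_rfl
  | succ n ih =>
    have h1 := ih (fun k hk => hx k (hk.trans n.lt_succ_self))
      (fun k hk => hz k (hk.trans n.le_succ))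
    exact (h1.mul ((measurable_unitGain (hx n n.lt_succ_self)).const_sub 1)).add
      ((hz (n + 1) le_rfl).sub (hz n n.le_succ))

/-- The integrand is adapted. -/
lemma measurable_integrand {mΩ : MeasurableSpace Ω} {T : ℝ} (𝓕 : Filtration ℝ mΩ)
    {X Z : ℝ → Ω → ℝ} (hX : ∀ t ∈ Icc 0 T, Measurable[𝓕 t] (X t))
    (hZ : ∀ t ∈ Icc 0 T, Measurable[𝓕 t] (Z t)) (hD : 0 < D) (hDt : D ≤ t) (htT : t ≤ T) (s : ℝ) :
    Measurable[𝓕 s]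
      (fun ω => integrand t D κ a (fun s => X s ω) (fun s => Z s ω) s) := by
  by_cases h : ∃ p : Σ n, Fin (cellCount D κ n),
      s ∈ Ioc (node t D κ p.1 p.2) (node t D κ p.1 (p.2 + 1))
  · obtain ⟨p, hp⟩ := h
    have heq : (fun ω => integrand t D κ a (fun s => X s ω) (fun s => Z s ω) s) =
        fun ω => position t D κ a (fun s => X s ω) (fun s => Z s ω) p := by
      ext ω
      unfold integrand
      rw [tsum_eq_single p, indicator_of_mem hp, Pi.one_apply, mul_one]
      intro q hq
      rw [indicator_of_notMem (fun h => hq (cell_unique hD h hp)), mul_zero]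
    rw [heq]
    -- At most one cell contains `s`, and cells are open on the left, so the position held at `s`
    -- uses only nodes strictly before `s`.
    have hmem : ∀ r, r ∈ Icc (t - D) t → r ∈ Icc 0 T := fun r hr =>
      ⟨by linarith [hr.1], hr.2.trans htT⟩
    have hXs : ∀ r ∈ Icc (t - D) t, r ≤ s → Measurable[𝓕 s] (X r) := fun r hr hrs =>
      (hX r (hmem r hr)).mono (𝓕.mono hrs) le_rfl
    have hZs : ∀ r ∈ Icc (t - D) t, r ≤ s → Measurable[𝓕 s] (Z r) := fun r hr hrs =>
      (hZ r (hmem r hr)).mono (𝓕.mono hrs) le_rfl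
    have hTs : dyadicTime t D p.1 ≤ s := (le_node hD κ p.1 p.2).trans hp.1.le
    unfold position
    have h1 : Measurable[𝓕 s] (fun ω =>
        target t D κ a (fun s => X s ω) (fun s => Z s ω) p.1) := by
      refine measurable_target (m := 𝓕 s) (x := fun ω s => X s ω) (z := fun ω s => Z s ω)
        (fun k hk j hj => hXs _ (node_mem hD hj) ?_) (fun k hk => hZs _ ?_ ?_)
      · exact (node_le hD κ hj).trans ((dyadicTime_mono hD (Nat.succ_le_of_lt hk)).trans hTs)
      · exact ⟨le_dyadicTime hD k, (dyadicTime_lt hD k).le⟩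
      · exact (dyadicTime_mono hD hk).trans hTs
    have h2 : Measurable[𝓕 s] (fun ω => unitPosition t D κ a (fun s => X s ω) p.1 p.2) :=
      measurable_unitPosition (m := 𝓕 s) (x := fun ω s => X s ω)
        (fun j hj => hXs _ (node_mem hD (hj.trans p.2.2.le))
          ((node_mono hD t κ p.1 hj).trans hp.1.le))
    exact h1.mul h2
  · push Not at h
    have heq : (fun ω => integrand t D κ a (fun s => X s ω) (fun s => Z s ω) s) = fun _ => 0 := by
      ext ω
      unfold integrand
      simp_rw [indicator_of_notMem (h _), mul_zero, tsum_zero]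
    rw [heq]
    exact measurable_const

end StrategyMeasurable

/-! ### Almost everywhere convergence of the right Weyl derivative. -/

section Cover

/-- Left neighbourhoods of the points of `(0,t]` cover almost all of `(0,t)` by countably many. -/
lemma exists_countable_cover_left {t : ℝ} (δ : ℝ → ℝ) (hδ : ∀ τ ∈ Ioc 0 t, 0 < δ τ) :
    ∃ S ⊆ Ioc 0 t, S.Countable ∧
      ∀ᵐ s ∂(volume.restrict (Ioo 0 t)), ∃ τ ∈ S, s ∈ Ioo (τ - δ τ) τ := by
  obtain ⟨S, hS, hSc, hSU⟩ := TopologicalSpace.isOpen_biUnion_countable (Ioc 0 t)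
    (fun τ => Ioo (τ - δ τ) τ) (fun τ _ => isOpen_Ioo)
  refine ⟨S, hS, hSc, ?_⟩
  set N : Set ℝ := Ioo 0 t \ ⋃ τ ∈ Ioc 0 t, Ioo (τ - δ τ) τ with hN
  have hNc : N.Countable := by
    -- An uncovered point `s` has its own left neighbourhood inside the union, hence disjoint from
    -- `N`. All points of `N` are isolated from the left, and a real set has only countably many
    -- such points.
    have hsub : N ⊆ {s ∈ N | 𝓝[N ∩ Iio s] s = ⊥} := ?_
    · exact (countable_setOfPred_isolated_left_within (s := N)).mono hsub
    intro s hs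
    refine ⟨hs, ?_⟩
    have hs0 : s ∈ Ioc 0 t := ⟨hs.1.1, hs.1.2.le⟩
    have : Ioo (s - δ s) s ∈ 𝓝[<] s := Ioo_mem_nhdsLT (by linarith [hδ s hs0])
    rw [inter_comm, nhdsWithin_inter', inf_principal_eq_bot]
    filter_upwards [this] with u hu huN
    exact huN.2 (mem_biUnion hs0 hu)
  have hN0 : ∀ᵐ s ∂(volume.restrict (Ioo 0 t)), s ∉ N :=
    ae_restrict_of_ae (hNc.ae_notMem volume)
  filter_upwards [hN0, ae_restrict_mem measurableSet_Ioo] with s hs hst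
  have : s ∈ ⋃ τ ∈ S, Ioo (τ - δ τ) τ := by
    rw [hSU]
    by_contra h
    exact hs ⟨hst, h⟩
  simpa only [mem_iUnion, exists_prop] using this

/-- Local Hölder continuity to the right of `s` makes the Weyl integral at `s` convergent. -/
lemma integrableOn_weyl_of_holder {g : ℝ → ℝ} {s τ t β γ K : ℝ} (hg : ContinuousOn g (Icc 0 t))
    (hγ : 1 - β < γ) (hs : 0 < s) (hsτ : s < τ) (hτt : τ ≤ t)
    (hK : ∀ u ∈ Ioo s τ, |g s - g u| ≤ K * |s - u| ^ γ) :
    IntegrableOn (fun u => (g s - g u) / (u - s) ^ ((1 - β) + 1)) (Ioo s t) := by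
  have hcont : ContinuousOn (fun u => (g s - g u) / (u - s) ^ ((1 - β) + 1)) (Ioc s t) := by
    refine ContinuousOn.div (continuousOn_const.sub (hg.mono fun u hu => ⟨hs.le.trans hu.1.le, hu.2⟩))
      (ContinuousOn.rpow_const (by fun_prop) fun u hu => Or.inl ?_) (fun u hu => ?_)
    · linarith [hu.1]
    · exact (Real.rpow_pos_of_pos (by linarith [hu.1]) _).ne'
  have h1 : IntegrableOn (fun u => (g s - g u) / (u - s) ^ ((1 - β) + 1)) (Ioo s τ) := by
    refine Integrable.mono' ((integrableOn_sub_rpow (a := s) (b := τ)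
      (by linarith : -1 < γ - ((1 - β) + 1))).const_mul K)
      ((hcont.mono fun u hu => ⟨hu.1, hu.2.le.trans hτt⟩).aestronglyMeasurable measurableSet_Ioo) ?_
    refine ae_restrict_of_forall_mem measurableSet_Ioo (fun u hu => ?_)
    have h2 : 0 < u - s := by linarith [hu.1]
    have h3 := hK u hu
    rw [abs_sub_comm s, abs_of_pos h2] at h3
    rw [norm_div, Real.norm_of_nonneg (by positivity : 0 ≤ (u - s) ^ ((1 - β) + 1)),
      div_le_iff₀ (by positivity), mul_assoc, ← Real.rpow_add h2, sub_add_cancel]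
    exact h3
  have h2 : IntegrableOn (fun u => (g s - g u) / (u - s) ^ ((1 - β) + 1)) (Icc τ t) :=
    (hcont.mono fun u hu => ⟨hsτ.trans_le hu.1, hu.2⟩).integrableOn_Icc
  refine (h1.union h2).mono_set (fun u hu => ?_)
  rcases lt_or_ge u τ with h | h
  · exact Or.inl ⟨hu.1, h⟩
  · exact Or.inr ⟨h, hu.2.le⟩

end Cover

/-! ### What the Gaussian class and the small ball assumption give for almost every path. -/

section GaussianPaths

variable {Ω : Type*} {mΩ : MeasurableSpace Ω} {P : Measure Ω}

/-- Processes of the class `𝒳^α_τ` are a.s. Hölder continuous close to `τ` of all orders below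
`α`. -/
lemma MemClass.ae_holder [IsProbabilityMeasure P] {α τ : ℝ} {X : ℝ → Ω → ℝ}
    (hX : MemClass P α τ X) : ∃ δ ∈ Ioc 0 τ, ∀ γ, 0 < γ → γ < α →
      ∀ᵐ ω ∂P, ∃ K, 0 ≤ K ∧ ∀ s ∈ Icc (τ - δ) τ, ∀ r ∈ Icc (τ - δ) τ,
        |X s ω - X r ω| ≤ K * |s - r| ^ γ := by
  obtain ⟨δ, hδ, hloc⟩ := hX.local_cov
  refine ⟨δ, hδ, fun γ hγ0 hγα => ?_⟩
  -- The shift to the left end `u = τ - δ` covers every pair of times in `[τ - δ, τ]` at once.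
  obtain ⟨C, -, hC⟩ := (hloc (τ - δ) ⟨le_rfl, by linarith [hδ.1]⟩).incVar_le
  have hsub : ∀ s ∈ Icc (τ - δ) τ, s ∈ Icc 0 τ := fun s hs => ⟨by linarith [hs.1, hδ.2], hs.2⟩
  have hgauss : ∀ s ∈ Icc (τ - δ) τ, HasGaussianLaw (X s) P := fun s hs =>
    hX.gaussian.hasGaussianLaw_eval ⟨s, hsub s hs⟩
  refine ae_exists_holder (C := C) (by linarith [hδ.1]) hγ0 hγα ?_ ?_ ?_ ?_
  · exact hX.continuous.mono fun ω hω => hω.mono fun s hs => hsub s hs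
  · intro s hs r hr
    exact hX.gaussian.hasGaussianLaw_fun_sub (s := ⟨s, hsub s hs⟩) (t := ⟨r, hsub r hr⟩)
  · intro s hs r hr
    rw [integral_sub (hgauss s hs).integrable (hgauss r hr).integrable,
      hX.centered s (hsub s hs), hX.centered r (hsub r hr), sub_zero]
  · intro s hs r hr hrs
    have h := hC (s - r) ⟨by linarith, by linarith [hs.2, hr.1]⟩ (r - (τ - δ))
      ⟨by linarith [hr.1], by linarith [hs.2]⟩
    unfold incVar shiftInc at h
    have e1 : s - r + (r - (τ - δ)) + (τ - δ) = s := by ring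
    have e2 : r - (τ - δ) + (τ - δ) = r := by ring
    simpa only [e1, e2, sub_sub_sub_cancel_right] using h

/-- Under the small ball assumption the path a.s. eventually exits from the balls of radius
`2 * threshold` during each dyadic interval. -/
lemma SmallBall.ae_eventually_exit [IsProbabilityMeasure P] {α t : ℝ} {X : ℝ → Ω → ℝ}
    (hα : 0 < α) (h : SmallBall P α t X) : ∃ D₀ > 0, ∀ D, 0 < D → D ≤ D₀ → ∀ a, α < a →
      ∀ᵐ ω ∂P, ∀ᶠ n in atTop, ∃ u ∈ Icc (dyadicTime t D n) (dyadicTime t D (n + 1)),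
        2 * threshold D a n < |X u ω - X (dyadicTime t D n) ω| := by
  obtain ⟨C, hC, δ, hδ, Δ, hΔ, hsb⟩ := h
  refine ⟨min δ (min Δ 1), lt_min hδ.1 (lt_min hΔ one_pos), fun D hD hDle a ha => ?_⟩
  have hDδ : D ≤ δ := hDle.trans (min_le_left _ _)
  have hDΔ : D ≤ Δ := hDle.trans ((min_le_right _ _).trans (min_le_left _ _))
  have hD1 : D ≤ 1 := hDle.trans ((min_le_right _ _).trans (min_le_right _ _))
  -- With radius `Δ^a` the small ball exponent is `C Δ Δ^(-a/α) = C Δ^e`. As `e < 0` it grows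
  -- geometrically in `n`, so the bounds are summable.
  set e := 1 - a / α with he
  have he0 : e < 0 := by
    have : 1 < a / α := (one_lt_div hα).2 ha
    simp only [he]; linarith
  have hmem : ∀ n, dyadicTime t D n ∈ Icc (t - δ) t := fun n =>
    ⟨by linarith [le_dyadicTime (t := t) hD n], (dyadicTime_lt hD n).le⟩
  have hb : ∀ n, P.real {ω | ∀ u ∈ Icc (dyadicTime t D n) (dyadicTime t D (n + 1)),
      |X u ω - X (dyadicTime t D n) ω| ≤ 2 * threshold D a n} ≤
      1 ^ n * Real.exp (-(C * (D / 2) ^ e * ((1 / 2 : ℝ) ^ e) ^ n)) := by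
    intro n
    have hl := dyadicLen_pos hD n
    have hl1 : dyadicLen D n ≤ 1 := (dyadicLen_le hD n).trans hD1
    have hsubt : dyadicTime t D (n + 1) - dyadicTime t D n = dyadicLen D n := by
      linarith [dyadicTime_add t D n]
    have hthr : 2 * threshold D a n = dyadicLen D n ^ a := by unfold threshold; ring
    have := hsb _ (hmem n) _ (hmem (n + 1)) (by linarith)
      (by rw [hsubt]; exact (dyadicLen_le hD n).trans hDΔ) (2 * threshold D a n)
      (by have := threshold_pos hD a n; positivity)
      (by rw [hsubt, hthr]; exact Real.rpow_le_rpow_of_exponent_ge hl hl1 ha.le)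
    refine this.trans (le_of_eq ?_)
    rw [one_pow, one_mul, mul_assoc C ((D / 2) ^ e), ← dyadicLen_rpow hD, hsubt, hthr,
      ← Real.rpow_mul hl.le, mul_assoc]
    congr 3
    rw [he, sub_eq_add_neg, Real.rpow_add hl, Real.rpow_one]
    congr 2; ring
  have hq : 1 < (1 / 2 : ℝ) ^ e :=
    Real.one_lt_rpow_of_pos_of_lt_one_of_neg (by norm_num) (by norm_num) he0
  have hev := ae_eventually_notMem_of_summable
    (summable_geometric_mul_exp_neg hq zero_le_one (by positivity : 0 < C * (D / 2) ^ e)) hb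
  filter_upwards [hev] with ω hω
  filter_upwards [hω] with n hn
  simpa only [mem_ofPred_eq, not_forall, not_le, exists_prop] using hn

end GaussianPaths

end GaussianRep

/-! ### The representation: choice of parameters and assembly. -/

theorem mainTheorem5 {Ω : Type*} {mΩ : MeasurableSpace Ω} (P : Measure Ω)
    [IsProbabilityMeasure P] [P.IsComplete]
    (T : ℝ) (hT : 0 < T) (α : ℝ) (hα : 1 / 2 < α) (hα1 : α < 1)
    (𝓕 : Filtration ℝ mΩ)
    (h𝓕 : ∀ t ∈ Set.Ioc 0 T, 𝓕 t = ⨆ s ∈ Set.Ico 0 t, 𝓕 s)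
    (X : ℝ → Ω → ℝ) (hXad : ∀ t ∈ Set.Icc 0 T, Measurable[𝓕 t] (X t))
    (hX : ∀ t ∈ Set.Ioc 0 T, GaussianRep.MemClass P α t X)
    (hsb : ∀ t ∈ Set.Ioc 0 T, GaussianRep.SmallBall P α t X)
    (Z : ℝ → Ω → ℝ) (hZad : ∀ t ∈ Set.Icc 0 T, Measurable[𝓕 t] (Z t))
    (a : ℝ≥0) (ha : 1 - α < a)
    (hZ : ∀ᵐ ω ∂P, ∃ K : ℝ≥0, HolderOnWith K a (fun t => Z t ω) (Set.Icc 0 T)) :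
    ∀ t ∈ Set.Ioc 0 T, ∃ Ψ : ℝ → Ω → ℝ,
      (∀ s ∈ Set.Icc 0 t, Measurable[𝓕 s] (Ψ s)) ∧
      ∃ β₀ ∈ Set.Ioo (1 - α) 1, ∀ᵐ ω ∂P, ∀ β ∈ Set.Ioc (1 - α) β₀,
        GaussianRep.HasGLSIntegral β (fun s => Ψ s ω) (fun s => X s ω) t (Z t ω) := by
  open GaussianRep in
  intro t ht
  have hholder : ∀ τ : ℝ, ∃ δ, τ ∈ Ioc 0 t → δ ∈ Ioc 0 τ ∧ ∀ γ, 0 < γ → γ < α →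
      ∀ᵐ ω ∂P, ∃ K, 0 ≤ K ∧ ∀ s ∈ Icc (τ - δ) τ, ∀ r ∈ Icc (τ - δ) τ,
        |X s ω - X r ω| ≤ K * |s - r| ^ γ := by
    intro τ
    by_cases hτ : τ ∈ Ioc 0 t
    · obtain ⟨δ, h1, h2⟩ := (hX τ ⟨hτ.1, hτ.2.trans ht.2⟩).ae_holder
      exact ⟨δ, fun _ => ⟨h1, h2⟩⟩
    · exact ⟨0, fun h => absurd h hτ⟩
  choose δ hδ using hholder
  obtain ⟨S, hS, hSc, hScover⟩ := exists_countable_cover_left δ (fun τ hτ => (hδ τ hτ).1.1)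
  have htt : t ∈ Ioc 0 t := ⟨ht.1, le_rfl⟩
  obtain ⟨hδt, hδh⟩ := hδ t htt
  obtain ⟨D₀, hD₀, hexit⟩ := (hsb t ht).ae_eventually_exit (by linarith)
  set D := min (δ t) (min D₀ 1) with hDdef
  have hD : 0 < D := lt_min hδt.1 (lt_min hD₀ one_pos)
  have hDδ : D ≤ δ t := min_le_left _ _
  have hDD₀ : D ≤ D₀ := (min_le_right _ _).trans (min_le_left _ _)
  have hD1 : D ≤ 1 := (min_le_right _ _).trans (min_le_right _ _)
  have hDt : D ≤ t := hDδ.trans hδt.2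
  -- The error recursion is closed only for ratios `2^(-b) ≥ 1/2`, hence the cap at 1. Because `D ≤
  -- 1`, Hölder of order `a` implies Hölder of order `b` on `[t - D, t]`.
  set b : ℝ := min (a : ℝ) 1 with hb
  have hb0 : 0 < b := lt_min (by linarith) one_pos
  have hb1 : b ≤ 1 := min_le_right _ _
  -- With path exponent `α - η` and threshold exponent `α + η`, the quadratic variation condition
  -- reads `κ(2α - 1) > 4η + 2κη`; `η = κ(2α - 1)/8` makes the left side `8η`. Summability of the
  -- positions needs `b > κ + η + (β - (1 - α))`, which holds as `κ = b/4`, `η ≤ b/32` and `β - (1 -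
  -- α) ≤ b/8`. None of these choices depends on `β`, so one integrand serves all orders.
  set κ := b / 4 with hκ
  have hκ0 : 0 < κ := by positivity
  set η := κ * (2 * α - 1) / 8 with hη
  have h2α : 0 < 2 * α - 1 := by linarith
  have hη0 : 0 < η := by positivity
  have hηκ : η ≤ κ / 8 := by
    have : κ * (2 * α - 1) ≤ κ * 1 := by gcongr; linarith
    simp only [hη]; linarith
  have hηα : η ≤ (2 * α - 1) / 32 := by
    have : κ * (2 * α - 1) ≤ 1 / 4 * (2 * α - 1) := by gcongr; linarith
    simp only [hη]; linarith
  have hexp : 0 < 2 * (α - η) + κ * (2 * (α - η) - 1) - 2 * (α + η) := by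
    have h1 : κ * (2 * α - 1) = 8 * η := by simp only [hη]; ring
    have h2 : κ * η ≤ 1 * η := by gcongr; linarith
    nlinarith
  refine ⟨fun s ω => integrand t D κ (α + η) (fun s => X s ω) (fun s => Z s ω) s,
    fun s _ => measurable_integrand 𝓕 hXad hZad hD hDt ht.2 s,
    1 - α + b / 8, ⟨by linarith, by linarith⟩, ?_⟩
  -- Countably many Hölder exponents increasing to `α`: the exceptional null set is fixed before
  -- `β`, and each `β > 1 - α` then finds some `γ k > 1 - β`.
  set γ : ℕ → ℝ := fun k => α - α / ((k : ℝ) + 2) with hγ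
  have hγ0 : ∀ k, 0 < γ k := by
    intro k
    have : α / ((k : ℝ) + 2) < α := by
      rw [div_lt_iff₀ (by positivity)]; nlinarith [(Nat.cast_nonneg k : (0 : ℝ) ≤ k)]
    simp only [hγ]; linarith
  have hγα : ∀ k, γ k < α := by
    intro k
    have : 0 < α / ((k : ℝ) + 2) := by positivity
    simp only [hγ]; linarith
  have hγlim : Tendsto γ atTop (𝓝 α) := by
    have h1 : Tendsto (fun k : ℕ => (k : ℝ) + 2) atTop atTop :=
      tendsto_natCast_atTop_atTop.atTop_add tendsto_const_nhds
    simpa using (tendsto_const_nhds (x := α)).sub (h1.const_div_atTop α)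
  have hall : ∀ᵐ ω ∂P, ∀ τ ∈ S, ∀ k, ∃ K, 0 ≤ K ∧ ∀ s ∈ Icc (τ - δ τ) τ,
      ∀ r ∈ Icc (τ - δ τ) τ, |X s ω - X r ω| ≤ K * |s - r| ^ γ k :=
    (ae_ball_iff hSc).2 fun τ hτ => ae_all_iff.2 fun k => (hδ τ (hS hτ)).2 _ (hγ0 k) (hγα k)
  have hallt : ∀ᵐ ω ∂P, ∀ k, ∃ K, 0 ≤ K ∧ ∀ s ∈ Icc (t - δ t) t,
      ∀ r ∈ Icc (t - δ t) t, |X s ω - X r ω| ≤ K * |s - r| ^ γ k :=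
    ae_all_iff.2 fun k => hδh _ (hγ0 k) (hγα k)
  filter_upwards [(hX t ht).continuous, hall, hallt, hδh (α - η) (by linarith) (by linarith), hZ,
    hexit D hD hDD₀ (α + η) (by linarith)] with ω hcont hloc hmain hquad hZω hex β hβ
  have hsub : ∀ s ∈ Icc (t - D) t, s ∈ Icc (t - δ t) t := fun s hs => ⟨by linarith [hs.1], hs.2⟩
  obtain ⟨K₁, hK₁0, hK₁⟩ := hquad
  obtain ⟨L, hL⟩ := hZω
  have hsubT : Icc (t - D) t ⊆ Icc 0 T := fun s hs => ⟨by linarith [hs.1], hs.2.trans ht.2⟩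
  have ha0 : (0 : ℝ≥0) < a := by
    have : (0 : ℝ) < a := by linarith
    exact_mod_cast this
  have hz : ∀ s ∈ Icc (t - D) t, ∀ r ∈ Icc (t - D) t, |Z s ω - Z r ω| ≤ L * |s - r| ^ b := by
    intro s hs r hr
    have h1 := hL.dist_le (hsubT hs) (hsubT hr)
    rw [Real.dist_eq, Real.dist_eq] at h1
    refine h1.trans ?_
    gcongr 1
    rcases (abs_nonneg (s - r)).eq_or_lt with h0 | h0
    · rw [← h0, Real.zero_rpow (by exact_mod_cast ha0.ne'), Real.zero_rpow hb0.ne']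
    · refine Real.rpow_le_rpow_of_exponent_ge h0 ?_ (min_le_left _ _)
      rw [abs_le]; constructor <;> linarith [hs.1, hs.2, hr.1, hr.2]
  have hzc : ContinuousWithinAt (fun s => Z s ω) (Icc (t - D) t) t :=
    ((hL.continuousOn ha0) t (hsubT ⟨by linarith, le_rfl⟩)).mono hsubT
  obtain ⟨B, hB0, hB⟩ := exists_target_bound (x := fun s => X s ω) (z := fun s => Z s ω) hD hD1
    (by linarith) hexp hK₁0 (fun s hs r hr => hK₁ s (hsub s hs) r (hsub r hr)) hb0.le hb1
    L.coe_nonneg hz hex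
  have hβ1 : β < 1 := by linarith [hβ.2]
  have hsum := summable_position hD hD1 hκ0 hβ1 (by linarith [hβ.2]) hB0 hB
  obtain ⟨k, hk⟩ := (hγlim.eventually (lt_mem_nhds (show 1 - β < α by linarith [hβ.1]))).exists
  obtain ⟨K, hK0, hK⟩ := hmain k
  have hK' : ∀ s ∈ Icc (t - D) t, ∀ r ∈ Icc (t - D) t, |X s ω - X r ω| ≤ K * |s - r| ^ γ k :=
    fun s hs r hr => hK s (hsub s hs) r (hsub r hr)
  have htsum := tsum_position_mul_sub hD hD1 hk.le hb0 hK0 hB hK' hzc hsum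
  -- Only the singularity at `u = s` matters, and almost every `s` lies in a left neighbourhood of
  -- some `τ` in the countable set `S` on which the path is Hölder of order `γ k > 1 - β`.
  have hconv : ∀ᵐ s ∂(volume.restrict (Ioo 0 t)), IntegrableOn
      (fun u => (X s ω - X u ω) / (u - s) ^ ((1 - β) + 1)) (Ioo s t) := by
    filter_upwards [hScover, ae_restrict_mem measurableSet_Ioo] with s ⟨τ, hτ, hsτ⟩ hs
    obtain ⟨K', -, hK''⟩ := hloc τ hτ k
    exact integrableOn_weyl_of_holder (g := fun s => X s ω) hcont hk hs.1 hsτ.2 (hS hτ).2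
      (fun u hu => hK'' s ⟨hsτ.1.le, hsτ.2.le⟩ u ⟨hsτ.1.le.trans hu.1.le, hu.2.le⟩)
  have hfinal := hasGLSIntegral_step (g := fun s => X s ω) (c := t - D) (t := t)
    ⟨by linarith [hβ.1], hβ1⟩ hk
    (by linarith) (by linarith) hcont hK' hconv
    (l := fun p : Σ n, Fin (cellCount D κ n) => node t D κ p.1 p.2)
    (r := fun p => node t D κ p.1 (p.2 + 1))
    (fun p => (node_mem hD p.2.2.le).1) (fun p => node_mono hD t κ p.1 (Nat.le_succ _))
    (fun p => (node_mem hD (Nat.succ_le_of_lt p.2.2)).2)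
    (fun s p q hp hq => cell_unique hD hp hq) hsum
  rw [htsum] at hfinal
  exact hfinal
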